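/- Let $n\ge 3$ and let $M$ be a nonempty smooth $n$-dimensional manifold (Hausdorff, second countable, without boundary). Let $\mathrm{Metr}(M)$ be the set of smooth Riemannian metrics on $M$. For $g\in\mathrm{Metr}(M)$ let $\mathrm{Ric}_g$, $\mathrm{scal}_g$, $\mu_g$ denote its Ricci tensor, scalar curvature and Riemannian measure, and put $$Y_M(g)=\inf\Bigl\{\tfrac{1}{\|v\|_{L^p(g)}^2}\int_M\bigl(a_n|dv|_g^2+\mathrm{scal}_g\,v^2\bigr)\,d\mu_g \;:\; v\in C_c^\infty(M,\mathbb R_{\ge0})\setminus\{0\}\Bigr\}\in\mathbb R\cup\{-\infty\},$$ where $p=\frac{2n}{n-2}$ and $a_n=\frac{4(n-1)}{n-2}$. The uniform $C^2$-topology on $\mathrm{Metr}(M)$ is the topology in which the sets $\{h : \|h-g\|_{C^2(g)}<\varepsilon\}$, $\varepsilon>0$, form a neighborhood basis at $g$; here $\|T\|_{C^2(g)}=\sum_{i=0}^2\sup_{x\in M}|\nabla^iT|_g(x)\in[0,\infty]$ with the Levi-Civita connection $\nabla$ of $g$. Then the map $Y_M\colon\mathrm{Metr}(M)\to\mathbb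 R\cup\{-\infty\}$ is upper semicontinuous with respect to the uniform $C^2$-topology. Moreover, $Y_M$ is continuous with respect to the uniform $C^2$-topology at every $g\in\mathrm{Metr}(M)$ that satisfies $Y_M(g)=-\infty$ or for which there are constants $\varepsilon,c>0$ with $$|\mathrm{Ric}_g|_g\le c\,(1+|\mathrm{scal}_g|)\ \text{ on } M\qquad\text{and}\qquad \|(\mathrm{scal}_g-\varepsilon)_-\|_{L^{n/2}(g)}<\infty,$$ where $f_-=-\min\{0,f\}$. -/

import Mathlib

open scoped Manifold ContDiff ENNReal Topology
open MeasureTheory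

namespace YamabeMap

noncomputable section

/-! ### Riemannian geometry in a coordinate domain

A Riemannian metric in coordinates is a matrix-valued function `G = (g_ij)` on `ℝⁿ`, and a covariant
tensor field of rank `m` in coordinates is given by its components `T I`, `I : Fin m → Fin n`. -/

/-- The coordinate space `ℝⁿ`. -/
abbrev Coord (n : ℕ) : Type := EuclideanSpace ℝ (Fin n)

variable {n : ℕ}

/-- The partial derivative `∂_i f`. -/
def pderiv (i : Fin n) (f : Coord n → ℝ) (y : Coord n) : ℝ :=
  fderiv ℝ f y (EuclideanSpace.single i 1)

/-- The Christoffel symbol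
`Γ_{ab}^c = (1/2) ∑_m g^{cm} (∂_a g_{bm} + ∂_b g_{am} - ∂_m g_{ab})`. -/
def christoffel (G : Coord n → Matrix (Fin n) (Fin n) ℝ) (a b c : Fin n) (y : Coord n) : ℝ :=
  (1 / 2) * ∑ m, (G y)⁻¹ c m *
    (pderiv a (fun z => G z b m) y + pderiv b (fun z => G z a m) y - pderiv m (fun z => G z a b) y)

/-- The components of the Ricci tensor,
`Ric_{ab} = ∑_c (∂_c Γ_{ab}^c - ∂_b Γ_{ac}^c + ∑_d Γ_{ab}^d Γ_{cd}^c - ∑_d Γ_{ac}^d Γ_{bd}^c)`. -/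
def ricciCoeff (G : Coord n → Matrix (Fin n) (Fin n) ℝ) (a b : Fin n) (y : Coord n) : ℝ :=
  ∑ c, (pderiv c (christoffel G a b c) y - pderiv b (christoffel G a c c) y
    + ∑ d, christoffel G a b d y * christoffel G c d c y
    - ∑ d, christoffel G a c d y * christoffel G b d c y)

/-- The scalar curvature `∑_{a,b} g^{ab} Ric_{ab}`. -/
def scalCoeff (G : Coord n → Matrix (Fin n) (Fin n) ℝ) (y : Coord n) : ℝ :=
  ∑ a, ∑ b, (G y)⁻¹ a b * ricciCoeff G a b y

/-- The components of the covariant derivative `∇T` of a covariant tensor field `T`, with respect to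
the Levi-Civita connection of `G`; the first index is the direction of differentiation:
`(∇T)_{l i₁ … i_m} = ∂_l T_{i₁ … i_m} - ∑_r ∑_s Γ_{l i_r}^s T_{i₁ … s … i_m}`
(with `s` in place of `i_r`). -/
def covDeriv (G : Coord n → Matrix (Fin n) (Fin n) ℝ) {m : ℕ}
    (T : (Fin m → Fin n) → Coord n → ℝ) (I : Fin (m + 1) → Fin n) (y : Coord n) : ℝ :=
  pderiv (I 0) (T (Fin.tail I)) y
    - ∑ r : Fin m, ∑ s : Fin n,
        christoffel G (I 0) (Fin.tail I r) s y * T (Function.update (Fin.tail I) r s) y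

/-- The components of the `i`-th covariant derivative `∇ⁱT` of a covariant tensor field of
rank `m`. -/
def iterCovDeriv (G : Coord n → Matrix (Fin n) (Fin n) ℝ) {m : ℕ}
    (T : (Fin m → Fin n) → Coord n → ℝ) : (i : ℕ) → (Fin (m + i) → Fin n) → Coord n → ℝ
  | 0 => T
  | i + 1 => covDeriv G (iterCovDeriv G T i)

/-- The pointwise norm of a covariant tensor of rank `m` induced by a scalar product with Gram
matrix `A`: `|T|² = ∑_{I,J} A^{i₁j₁} ⋯ A^{i_m j_m} T_I T_J`, where `(A^{ij})` is the inverse of `A`.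
It is equal to `∑ T(e_{i₁}, …, e_{i_m})²` for every orthonormal basis `(e_i)`. -/
def tensorNorm (A : Matrix (Fin n) (Fin n) ℝ) {m : ℕ} (T : (Fin m → Fin n) → ℝ) : ℝ :=
  Real.sqrt (∑ I, ∑ J, (∏ r, A⁻¹ (I r) (J r)) * T I * T J)

/-! ### A fixed choice of charts

All pointwise quantities below (curvatures, norms of tensors) are independent of the chart in which
they are computed. We compute them in charts taken from a fixed countable family, such that each
chart of the family is used on a Borel set that is relatively compact in its domain. -/

section Charts

variable (n) (M : Type*) [TopologicalSpace M] [SecondCountableTopology M] [Nonempty M]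
  [ChartedSpace (Coord n) M]

theorem exists_chartCover : ∃ (c : ℕ → M) (U : ℕ → Set M), (∀ k, IsOpen (U k)) ∧
    (∀ k, ∃ K, IsCompact K ∧ U k ⊆ K ∧ K ⊆ (chartAt (Coord n) (c k)).source) ∧
    ∀ x, ∃ k, x ∈ U k := by
  have : LocallyCompactSpace M := ChartedSpace.locallyCompactSpace (Coord n) M
  have h : ∀ x : M, ∃ K, IsCompact K ∧ K ∈ 𝓝 x ∧ K ⊆ (chartAt (Coord n) x).source := by
    intro x
    obtain ⟨K, hK, hKs, hKc⟩ := local_compact_nhds (chart_source_mem_nhds (Coord n) x)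
    exact ⟨K, hKc, hK, hKs⟩
  choose K hKc hKn hKs using h
  obtain ⟨s, hs, hcov⟩ :=
    TopologicalSpace.countable_cover_nhds (f := fun x => interior (K x))
      (fun x => interior_mem_nhds.2 (hKn x))
  have hne : s.Nonempty := by
    by_contra hcon
    rw [Set.not_nonempty_iff_eq_empty] at hcon
    subst hcon
    have : (Classical.arbitrary M) ∈ (Set.univ : Set M) := trivial
    rw [← hcov] at this
    simp at this
  obtain ⟨c, rfl⟩ := hs.exists_eq_range hne
  refine ⟨c, fun k => interior (K (c k)), fun k => isOpen_interior,
    fun k => ⟨K (c k), hKc _, interior_subset, hKs _⟩, fun x => ?_⟩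
  have : x ∈ (Set.univ : Set M) := trivial
  rw [← hcov] at this
  simpa using this

/-- The `k`-th chart of a fixed countable family of charts of `M`. -/
def coverChart (k : ℕ) : OpenPartialHomeomorph M (Coord n) :=
  chartAt (Coord n) ((exists_chartCover n M).choose k)

/-- Open sets that cover `M`, where `coverSet n M k` is relatively compact in the domain of the
`k`-th chart of the fixed family. -/
def coverSet (k : ℕ) : Set M :=
  (exists_chartCover n M).choose_spec.choose k

theorem isOpen_coverSet (k : ℕ) : IsOpen (coverSet n M k) :=
  (exists_chartCover n M).choose_spec.choose_spec.1 k

theorem exists_isCompact_coverSet (k : ℕ) :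
    ∃ K, IsCompact K ∧ coverSet n M k ⊆ K ∧ K ⊆ (coverChart n M k).source :=
  (exists_chartCover n M).choose_spec.choose_spec.2.1 k

variable {M}

theorem exists_mem_coverSet (x : M) : ∃ k, x ∈ coverSet n M k :=
  (exists_chartCover n M).choose_spec.choose_spec.2.2 x

open Classical in
/-- The first `k` with `x ∈ coverSet n M k`. -/
def chartIndex (x : M) : ℕ := Nat.find (exists_mem_coverSet n x)

/-- The chart around `x` in which pointwise quantities at `x` are computed. -/
def goodChart (x : M) : OpenPartialHomeomorph M (Coord n) := coverChart n M (chartIndex n x)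

open Classical in
theorem mem_goodChart_source (x : M) : x ∈ (goodChart n x).source := by
  obtain ⟨K, -, hUK, hKs⟩ := exists_isCompact_coverSet n M (chartIndex n x)
  exact hKs (hUK (Nat.find_spec (exists_mem_coverSet n x)))

end Charts

/-- The set of smooth, compactly supported functions `v ≥ 0` on `M` that do not vanish
identically. -/
def testFunctions (n : ℕ) (M : Type*) [TopologicalSpace M] [ChartedSpace (Coord n) M] :
    Set (M → ℝ) :=
  {v | ContMDiff (𝓡 n) 𝓘(ℝ) ∞ v ∧ HasCompactSupport v ∧ (∀ x, 0 ≤ v x) ∧ v ≠ 0}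

/-! ### Riemannian metrics on a manifold -/

section Manifold

variable (n) (M : Type*) [TopologicalSpace M] [ChartedSpace (Coord n) M]
  [IsManifold (𝓡 n) ∞ M]

/-- The set of (smooth) Riemannian metrics on `M`. -/
abbrev Metr : Type _ :=
  Bundle.ContMDiffRiemannianMetric (𝓡 n) ∞ (Coord n) (fun x : M => TangentSpace (𝓡 n) x)

variable {n M}

/-- The coefficients `g_ij = g(∂_i, ∂_j)` of `g` in the chart `e`, as functions of the
coordinates. -/
def metricCoeff (g : Metr n M) (e : OpenPartialHomeomorph M (Coord n)) (y : Coord n) :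
    Matrix (Fin n) (Fin n) ℝ :=
  Matrix.of fun i j => g.inner (e.symm y)
    (mfderiv 𝓘(ℝ, Coord n) (𝓡 n) e.symm y (EuclideanSpace.single i (1 : ℝ) : Coord n))
    (mfderiv 𝓘(ℝ, Coord n) (𝓡 n) e.symm y (EuclideanSpace.single j (1 : ℝ) : Coord n))

variable [SecondCountableTopology M] [Nonempty M]

/-- The scalar curvature `scal_g`. -/
def scal (g : Metr n M) (x : M) : ℝ :=
  scalCoeff (metricCoeff g (goodChart n x)) (goodChart n x x)

/-- The pointwise norm `|Ric_g|_g` of the Ricci tensor. -/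
def ricciNorm (g : Metr n M) (x : M) : ℝ :=
  tensorNorm (metricCoeff g (goodChart n x) (goodChart n x x))
    (fun I : Fin 2 → Fin n =>
      ricciCoeff (metricCoeff g (goodChart n x)) (I 0) (I 1) (goodChart n x x))

/-- The pointwise norm `|dv|_g` of the differential of a function `v`. -/
def diffNorm (g : Metr n M) (v : M → ℝ) (x : M) : ℝ :=
  tensorNorm (metricCoeff g (goodChart n x) (goodChart n x x))
    (fun I : Fin 1 → Fin n => pderiv (I 0) (v ∘ (goodChart n x).symm) (goodChart n x x))

/-- The Riemannian measure `μ_g`: on the Borel set of points whose chart index is `k`, it is the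
measure with density `√(det (g_ij))` with respect to Lebesgue measure in the `k`-th chart. -/
def riemMeasure [MeasurableSpace M] (g : Metr n M) : Measure M :=
  Measure.sum fun k : ℕ =>
    ((((volume : Measure (Coord n)).restrict (coverChart n M k).target).withDensity
      (fun y => ENNReal.ofReal (Real.sqrt (metricCoeff g (coverChart n M k) y).det))).map
        (coverChart n M k).symm).restrict {x | chartIndex n x = k}

/-- The pointwise norm `|∇ⁱ(h - g)|_g`, where `∇` is the Levi-Civita connection of `g`. -/
def covDerivDiffNorm (g h : Metr n M) (i : ℕ) (x : M) : ℝ :=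
  tensorNorm (metricCoeff g (goodChart n x) (goodChart n x x))
    (fun J => iterCovDeriv (metricCoeff g (goodChart n x))
      (fun (I : Fin 2 → Fin n) y => metricCoeff h (goodChart n x) y (I 0) (I 1)
        - metricCoeff g (goodChart n x) y (I 0) (I 1)) i J (goodChart n x x))

/-- The norm `‖h - g‖_{C^k(g)} = ∑_{i ≤ k} sup_x |∇ⁱ(h - g)|_g(x) ∈ [0, ∞]`. -/
def ckDist (k : ℕ) (g h : Metr n M) : ℝ≥0∞ :=
  ∑ i ∈ Finset.range (k + 1), ⨆ x : M, ENNReal.ofReal (covDerivDiffNorm g h i x)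

/-- The set of all metrics `h` with `‖h - g‖_{C^k(g)} < ε`. -/
def uniformBall (k : ℕ) (g : Metr n M) (ε : ℝ) : Set (Metr n M) :=
  {h | ckDist k g h < ENNReal.ofReal ε}

theorem uniformBall_mono (k : ℕ) (g : Metr n M) {ε δ : ℝ} (h : ε ≤ δ) :
    uniformBall k g ε ⊆ uniformBall k g δ :=
  fun _ hh => lt_of_lt_of_le hh (ENNReal.ofReal_le_ofReal h)

variable (n M) in
/-- The uniform `C^k`-topology on the set of Riemannian metrics: the sets `uniformBall k g ε` with
`ε > 0` are declared to be a neighborhood basis at `g`, i.e. a set is open if and only if it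
contains such a set for each of its points `g`. -/
abbrev uniformTopology (k : ℕ) : TopologicalSpace (Metr n M) where
  IsOpen U := ∀ g ∈ U, ∃ ε : ℝ, 0 < ε ∧ uniformBall k g ε ⊆ U
  isOpen_univ := fun _ _ => ⟨1, one_pos, Set.subset_univ _⟩
  isOpen_inter := by
    intro U V hU hV g hg
    obtain ⟨ε, hε, hεU⟩ := hU g hg.1
    obtain ⟨δ, hδ, hδV⟩ := hV g hg.2
    exact ⟨min ε δ, lt_min hε hδ, Set.subset_inter
      ((uniformBall_mono k g (min_le_left _ _)).trans hεU)
      ((uniformBall_mono k g (min_le_right _ _)).trans hδV)⟩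
  isOpen_sUnion := by
    intro S hS g hg
    obtain ⟨U, hUS, hgU⟩ := hg
    obtain ⟨ε, hε, hεU⟩ := hS U hUS g hgU
    exact ⟨ε, hε, hεU.trans (Set.subset_sUnion_of_mem hUS)⟩

/-! ### The Yamabe map -/

/-- The functional `E_g(v) = ‖v‖_{L^p(g)}^{-2} ∫_M (a_n |dv|_g² + scal_g v²) dμ_g`, where
`p = 2n/(n-2)` and `a_n = 4(n-1)/(n-2)`. -/
def yamabeFunctional [MeasurableSpace M] (g : Metr n M) (v : M → ℝ) : ℝ :=
  (∫ x, (4 * ((n : ℝ) - 1) / ((n : ℝ) - 2) * diffNorm g v x ^ 2 + scal g x * v x ^ 2)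
      ∂(riemMeasure g))
    / (eLpNorm v (ENNReal.ofReal (2 * (n : ℝ) / ((n : ℝ) - 2))) (riemMeasure g)).toReal ^ 2

/-- The Yamabe constant `Y_M(g) = inf {E_g(v) | v ∈ testFunctions n M} ∈ ℝ ∪ {-∞}`. -/
def yamabe [MeasurableSpace M] (g : Metr n M) : EReal :=
  ⨅ v ∈ testFunctions n M, ((yamabeFunctional g v : ℝ) : EReal)

end Manifold

end

end YamabeMap

set_option maxSynthPendingDepth 3

/-! The first half of the argument is a pointwise perturbation estimate. Let h be a metric with ‖h -
g‖_{C²(g)} ≤ δ, and let D be the difference of the two Levi-Civita connections. The Koszul formula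
gives h(D(a,b),m) in terms of ∇(h - g) (`metric_connDiff`). Differentiating it gives ∇D in terms of
∇²(h - g) (`metric_covConn`). The curvatures differ by an antisymmetrized ∇D plus D∗D
(`curvVec_sub`). In a frame orthonormal for g and orthogonal for h, every estimate becomes a
statement about the eigenvalues of h relative to g, which lie within δ of 1. Hence the measures and
|dv|² change by factors close to 1, while |scal_h - scal_g| ≤ Cδ(1 + |Ric_g|)
(`abs_scalCoeff_sub_le`). The Ricci norm enters because h⁻¹ weights the components of Ric_g
differently from g⁻¹.

Integrating, the numerator of the Yamabe functional changes by at most a small multiple of I(v) = ∫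
(a_n|dv|² + (1 + |Ric_g| + |scal_g|)v²), and the denominator by a factor close to 1
(`exists_closeMetrics_functional_bounds`). For fixed v the integral I(v) is finite, so each E_g(v)
depends continuously on g, and the infimum over v is upper semicontinuous.

Lower semicontinuity at g needs uniformity in v. With w = (scal_g - ε)_-, the function scal_g + 2w
dominates both |scal_g| and ε. The Ricci hypothesis therefore bounds I(v) by C(Q(v) + 2∫wv²), where
Q is the numerator for g, and Hölder's inequality gives ∫wv² ≤ ‖w‖_{n/2}‖v‖_p². The error is thus a
small multiple of Q and ‖v‖_p², and it can be absorbed (`lower_energy_estimate`). If Y_M(g) = -∞,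
lower semicontinuity is trivial.

The C²-norm depends on its base metric, so it is not obvious that balls are neighborhoods. A
triangle inequality up to a constant (`JetBound.trans`) settles this. -/

namespace YamabeMap

/-! ### Covariant derivatives and curvature of two connections, in coordinate-free form. -/

section Calculus

variable {V : Type*} [NormedAddCommGroup V] [NormedSpace ℝ V]

/-- The covariant derivative `(∇_w T)(u, v)` of a field of bilinear forms, where the connection is
given by its difference `Γ` to the flat connection. -/
noncomputable def cov1 (Γ : V → V →L[ℝ] V →L[ℝ] V) (T : V → V →L[ℝ] V →L[ℝ] ℝ) (z w u v : V) : ℝ :=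
  fderiv ℝ T z w u v - T z (Γ z w u) v - T z u (Γ z w v)

/-- The second covariant derivative `(∇_e ∇T)(w, u, v)` of a field of bilinear forms. -/
noncomputable def cov2 (Γ : V → V →L[ℝ] V →L[ℝ] V) (T : V → V →L[ℝ] V →L[ℝ] ℝ)
    (z e w u v : V) : ℝ :=
  fderiv ℝ (fun z' => cov1 Γ T z' w u v) z e - cov1 Γ T z (Γ z e w) u v
    - cov1 Γ T z w (Γ z e u) v - cov1 Γ T z w u (Γ z e v)

/-- The covariant derivative `(∇_e D)(a, b)` of a field of vector-valued bilinear maps. -/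
noncomputable def covConn (Γ : V → V →L[ℝ] V →L[ℝ] V) (D : V → V →L[ℝ] V →L[ℝ] V)
    (z e a b : V) : V :=
  fderiv ℝ D z e a b + Γ z e (D z a b) - D z (Γ z e a) b - D z a (Γ z e b)

/-- The vector-valued trilinear map whose trace over the last argument is the Ricci tensor. -/
noncomputable def curvVec (Γ : V → V →L[ℝ] V →L[ℝ] V) (z u v w : V) : V :=
  fderiv ℝ Γ z w u v - fderiv ℝ Γ z v u w + Γ z w (Γ z u v) - Γ z v (Γ z u w)

/-- `Γ` represents the Levi-Civita connection of `G` at `z`. -/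
structure IsLeviCivitaAt (G : V → V →L[ℝ] V →L[ℝ] ℝ) (Γ : V → V →L[ℝ] V →L[ℝ] V) (z : V) :
    Prop where
  symm_metric : ∀ u v, G z u v = G z v u
  symm_deriv : ∀ w u v, fderiv ℝ G z w u v = fderiv ℝ G z w v u
  symm : ∀ u v, Γ z u v = Γ z v u
  koszul : ∀ u v w, G z (Γ z u v) w =
    (1 / 2) * (fderiv ℝ G z u v w + fderiv ℝ G z v u w - fderiv ℝ G z w u v)

variable {G H E T : V → V →L[ℝ] V →L[ℝ] ℝ} {Γ Γ' D : V → V →L[ℝ] V →L[ℝ] V} {z : V}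

theorem IsLeviCivitaAt.cov1_self (h : IsLeviCivitaAt G Γ z) (w u v : V) :
    cov1 Γ G z w u v = 0 := by
  unfold cov1
  rw [h.symm_metric u, h.koszul, h.koszul, h.symm_deriv w v u, h.symm_deriv v w u, h.symm_deriv u w v]
  ring

theorem cov1_sub (hH : DifferentiableAt ℝ H z) (hG : DifferentiableAt ℝ G z) (w u v : V) :
    cov1 Γ (H - G) z w u v = cov1 Γ H z w u v - cov1 Γ G z w u v := by
  unfold cov1
  rw [fderiv_sub hH hG]
  simp
  ring

theorem cov1_add (hH : DifferentiableAt ℝ H z) (hG : DifferentiableAt ℝ G z) (w u v : V) :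
    cov1 Γ (H + G) z w u v = cov1 Γ H z w u v + cov1 Γ G z w u v := by
  unfold cov1
  rw [fderiv_add hH hG]
  simp
  ring

/-- The difference of two Levi-Civita connections in terms of the covariant derivative of the
difference of the metrics. -/
theorem metric_connDiff (hG : IsLeviCivitaAt G Γ z) (hH : IsLeviCivitaAt H Γ' z)
    (dG : DifferentiableAt ℝ G z) (dH : DifferentiableAt ℝ H z) (a b m : V) :
    H z ((Γ' - Γ) z a b) m = (1 / 2) * (cov1 Γ (H - G) z a b m + cov1 Γ (H - G) z b a m
      - cov1 Γ (H - G) z m a b) := by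
  simp only [cov1_sub dH dG, hG.cov1_self, sub_zero]
  simp only [Pi.sub_apply, sub_apply, map_sub, hH.koszul]
  unfold cov1
  rw [hG.symm b a, hG.symm m a, hG.symm m b, hH.symm_metric b, hH.symm_metric a,
    hH.symm_metric _ b]
  rw [hH.symm_metric _ a, hH.symm_metric b (Γ z a m)]
  ring

theorem ContDiffAt.cov1_differentiableAt (hT : ContDiffAt ℝ 2 T z) (hΓ : DifferentiableAt ℝ Γ z)
    (w u v : V) : DifferentiableAt ℝ (fun z' => cov1 Γ T z' w u v) z := by
  have h1 : DifferentiableAt ℝ (fderiv ℝ T) z :=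
    (hT.fderiv_right (m := 1) (by norm_num)).differentiableAt (by norm_num)
  have h2 : DifferentiableAt ℝ T z := hT.differentiableAt (by norm_num)
  unfold cov1
  fun_prop

theorem fderiv_apply₂ {F : Type*} [NormedAddCommGroup F] [NormedSpace ℝ F]
    {T : V → V →L[ℝ] V →L[ℝ] F} {a b : V → V} (hT : DifferentiableAt ℝ T z)
    (ha : DifferentiableAt ℝ a z) (hb : DifferentiableAt ℝ b z) (e : V) :
    fderiv ℝ (fun z => T z (a z) (b z)) z e =
      fderiv ℝ T z e (a z) (b z) + T z (fderiv ℝ a z e) (b z) + T z (a z) (fderiv ℝ b z e) := by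
  rw [fderiv_clm_apply (by fun_prop) (by fun_prop), fderiv_clm_apply (by fun_prop) (by fun_prop)]
  simp
  abel

/-- This is the covariant derivative of the identity `metric_connDiff` in direction e. The last term
appears because H is not parallel for Γ: since ∇G = 0, its derivative is ∇_e H = ∇_e(H - G). -/
theorem metric_covConn (hG : ∀ᶠ z in 𝓝 z, IsLeviCivitaAt G Γ z)
    (hH : ∀ᶠ z in 𝓝 z, IsLeviCivitaAt H Γ' z) (dG : ContDiffAt ℝ 2 G z) (dH : ContDiffAt ℝ 2 H z)
    (dΓ : DifferentiableAt ℝ Γ z) (dΓ' : DifferentiableAt ℝ Γ' z) (e a b m : V) :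
    H z (covConn Γ (Γ' - Γ) z e a b) m = (1 / 2) * (cov2 Γ (H - G) z e a b m
      + cov2 Γ (H - G) z e b a m - cov2 Γ (H - G) z e m a b)
      - cov1 Γ (H - G) z e ((Γ' - Γ) z a b) m := by
  have dG1 : DifferentiableAt ℝ G z := dG.differentiableAt (by norm_num)
  have dH1 : DifferentiableAt ℝ H z := dH.differentiableAt (by norm_num)
  have hev : (fun z => H z ((Γ' - Γ) z a b) m) =ᶠ[𝓝 z]
      fun z => (1 / 2) * (cov1 Γ (H - G) z a b m + cov1 Γ (H - G) z b a m
        - cov1 Γ (H - G) z m a b) := by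
    filter_upwards [hG, hH, dG.eventually (by simp), dH.eventually (by simp)] with z h1 h2 h3 h4
    exact metric_connDiff h1 h2 (h3.differentiableAt (by norm_num))
      (h4.differentiableAt (by norm_num)) a b m
  have dE : ContDiffAt ℝ 2 (H - G) z := dH.sub dG
  have hd := congrArg (fun L : V →L[ℝ] ℝ => L e) hev.fderiv_eq
  have dD : DifferentiableAt ℝ (Γ' - Γ) z := dΓ'.sub dΓ
  have d1 := ContDiffAt.cov1_differentiableAt dE dΓ a b m
  have d2 := ContDiffAt.cov1_differentiableAt dE dΓ b a m
  have d3 := ContDiffAt.cov1_differentiableAt dE dΓ m a b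
  rw [fderiv_const_mul ((d1.fun_add d2).fun_sub d3), fderiv_fun_sub (d1.fun_add d2) d3,
    fderiv_fun_add d1 d2,
    fderiv_apply₂ (F := ℝ) dH1 (by fun_prop) (by fun_prop),
    fderiv_apply₂ dD (by fun_prop) (by fun_prop)] at hd
  simp only [fderiv_fun_const, Pi.zero_apply, zero_apply, map_zero, add_zero,
    smul_apply, add_apply, sub_apply,
    smul_eq_mul] at hd
  have k := metric_connDiff hG.self_of_nhds hH.self_of_nhds dG1 dH1
  have hE1 : cov1 Γ (H - G) z e ((Γ' - Γ) z a b) m = fderiv ℝ H z e ((Γ' - Γ) z a b) m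
      - H z (Γ z e ((Γ' - Γ) z a b)) m - H z ((Γ' - Γ) z a b) (Γ z e m) := by
    rw [cov1_sub dH1 dG1, hG.self_of_nhds.cov1_self, sub_zero, cov1]
  rw [hE1]
  have k1 := k (Γ z e a) b m
  have k2 := k a (Γ z e b) m
  have k3 := k a b (Γ z e m)
  unfold covConn cov2
  simp only [map_add, map_sub, add_apply, sub_apply]
  linarith

theorem cov1_connDiff (w u v : V) :
    cov1 Γ T z w u v = cov1 Γ' T z w u v + T z ((Γ' - Γ) z w u) v + T z u ((Γ' - Γ) z w v) := by
  simp only [cov1, Pi.sub_apply, sub_apply, map_sub]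
  ring

/-- Apply ∇ to ∇T = ∇'T + T∗D. Replacing ∇ by ∇' on ∇'T costs the three terms with `cov1 Γ'`, and
the product rule on T∗D gives the terms with `cov1 Γ` and with ∇D. The formula moves second-order
bounds from one base metric to another. -/
theorem cov2_connDiff (hT : ContDiffAt ℝ 2 T z) (dΓ : DifferentiableAt ℝ Γ z)
    (dΓ' : DifferentiableAt ℝ Γ' z) (e w u v : V) :
    cov2 Γ T z e w u v = cov2 Γ' T z e w u v
      + cov1 Γ' T z ((Γ' - Γ) z e w) u v + cov1 Γ' T z w ((Γ' - Γ) z e u) v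
      + cov1 Γ' T z w u ((Γ' - Γ) z e v)
      + cov1 Γ T z e ((Γ' - Γ) z w u) v + T z (covConn Γ (Γ' - Γ) z e w u) v
      + cov1 Γ T z e u ((Γ' - Γ) z w v) + T z u (covConn Γ (Γ' - Γ) z e w v) := by
  have hT1 : DifferentiableAt ℝ T z := hT.differentiableAt (by norm_num)
  have dD : DifferentiableAt ℝ (Γ' - Γ) z := dΓ'.sub dΓ
  have hd : fderiv ℝ (fun z => cov1 Γ T z w u v) z e = fderiv ℝ (fun z => cov1 Γ' T z w u v) z e
      + (fderiv ℝ T z e ((Γ' - Γ) z w u) v + T z (fderiv ℝ (Γ' - Γ) z e w u) v)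
      + (fderiv ℝ T z e u ((Γ' - Γ) z w v) + T z u (fderiv ℝ (Γ' - Γ) z e w v)) := by
    have : (fun z => cov1 Γ T z w u v) = fun z => cov1 Γ' T z w u v + T z ((Γ' - Γ) z w u) v
        + T z u ((Γ' - Γ) z w v) := by
      funext z
      exact cov1_connDiff w u v
    have d1 := ContDiffAt.cov1_differentiableAt hT dΓ' w u v
    rw [this, fderiv_fun_add (by fun_prop) (by fun_prop), fderiv_fun_add d1 (by fun_prop)]
    simp only [add_apply]
    rw [fderiv_apply₂ (F := ℝ) (a := fun z => (Γ' - Γ) z w u) hT1 (by fun_prop) (by fun_prop),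
      fderiv_apply₂ (F := ℝ) (b := fun z => (Γ' - Γ) z w v) hT1 (by fun_prop) (by fun_prop),
      fderiv_apply₂ dD (by fun_prop) (by fun_prop), fderiv_apply₂ dD (by fun_prop) (by fun_prop)]
    simp
  unfold cov2
  rw [hd]
  simp only [cov1, covConn, Pi.sub_apply, sub_apply, map_sub, map_add,
    add_apply]
  ring

/-- Symmetry of both connections makes the terms D(u, Γ(w,v)) of the two covariant derivatives
cancel and matches the remaining Γ∗D terms with the cross terms of Γ'∗Γ'. Only ∇D and D∗D survive.
-/
theorem curvVec_sub (hs : ∀ u v, Γ z u v = Γ z v u) (hs' : ∀ u v, Γ' z u v = Γ' z v u)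
    (dΓ : DifferentiableAt ℝ Γ z) (dΓ' : DifferentiableAt ℝ Γ' z) (u v w : V) :
    curvVec Γ' z u v w - curvVec Γ z u v w =
      covConn Γ (Γ' - Γ) z w u v - covConn Γ (Γ' - Γ) z v u w
      + (Γ' - Γ) z w ((Γ' - Γ) z u v) - (Γ' - Γ) z v ((Γ' - Γ) z u w) := by
  unfold curvVec covConn
  rw [fderiv_sub dΓ' dΓ]
  simp only [Pi.sub_apply, sub_apply, map_sub]
  rw [hs w v, hs w u, hs v u, hs' (Γ z u w) v, hs (Γ z u w) v, hs' (Γ z u v) w, hs (Γ z u v) w]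
  abel

end Calculus

end YamabeMap

namespace YamabeMap

/-! ### Estimates for the difference of two Levi-Civita connections. -/

section Bounds

variable {V : Type*} [NormedAddCommGroup V] [NormedSpace ℝ V]
variable {G H T : V → V →L[ℝ] V →L[ℝ] ℝ} {Γ Γ' : V → V →L[ℝ] V →L[ℝ] V} {z : V}

/-- The length of a vector with respect to a bilinear form. -/
noncomputable def gnorm (B : V →L[ℝ] V →L[ℝ] ℝ) (u : V) : ℝ := √(B u u)

theorem gnorm_nonneg (B : V →L[ℝ] V →L[ℝ] ℝ) (u : V) : 0 ≤ gnorm B u := Real.sqrt_nonneg _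

/-- Division by the length, which the square root makes zero when B u u ≤ 0. It turns a bound for x
tested against itself into a bound for the length of x. -/
theorem gnorm_le_of_apply_le {B : V →L[ℝ] V →L[ℝ] ℝ} {u : V} {K : ℝ} (hK : 0 ≤ K)
    (h : B u u ≤ K * gnorm B u) : gnorm B u ≤ K := by
  rcases le_or_gt (B u u) 0 with h0 | h0
  · rw [gnorm, Real.sqrt_eq_zero_of_nonpos h0]
    exact hK
  · have h1 : gnorm B u * gnorm B u = B u u := Real.mul_self_sqrt h0.le
    have h2 : 0 < gnorm B u := Real.sqrt_pos.2 h0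
    rw [← h1] at h
    exact le_of_mul_le_mul_right h h2

theorem gnorm_le_two_mul {B C : V →L[ℝ] V →L[ℝ] ℝ} {u : V} (h : B u u ≤ 4 * C u u) :
    gnorm B u ≤ 2 * gnorm C u := by
  unfold gnorm
  calc √(B u u) ≤ √(2 ^ 2 * C u u) := Real.sqrt_le_sqrt (by linarith)
    _ = 2 * √(C u u) := by rw [Real.sqrt_mul (by positivity), Real.sqrt_sq (by norm_num)]

/-- The Levi-Civita connection `Γ` of the metric `G` near a point. -/
structure IsMetricNear (G : V → V →L[ℝ] V →L[ℝ] ℝ) (Γ : V → V →L[ℝ] V →L[ℝ] V) (z : V) :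
    Prop where
  leviCivita : ∀ᶠ z in 𝓝 z, IsLeviCivitaAt G Γ z
  contDiffAt : ContDiffAt ℝ 2 G z
  differentiableAt_conn : DifferentiableAt ℝ Γ z

variable (hG : IsMetricNear G Γ z) (hH : IsMetricNear H Γ' z)
  (hle : ∀ u, G z u u ≤ 2 * H z u u) {δ : ℝ} (hδ0 : 0 ≤ δ)
  (h1 : ∀ w u v, |cov1 Γ (H - G) z w u v| ≤ δ * (gnorm (G z) w * gnorm (G z) u * gnorm (G z) v))

include hG hH hle hδ0 h1

/-- Test the Koszul identity for x = D(a,b) against x itself. The constant is 2 (from G ≤ 2H) times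
1/2 times three terms. -/
theorem gnorm_connDiff_le (a b : V) :
    gnorm (G z) ((Γ' - Γ) z a b) ≤ 3 * δ * (gnorm (G z) a * gnorm (G z) b) := by
  set N := gnorm (G z)
  have hN : ∀ u, 0 ≤ N u := gnorm_nonneg _
  have := hN a
  have := hN b
  refine gnorm_le_of_apply_le (by positivity) ?_
  set x := (Γ' - Γ) z a b with hx
  refine (hle x).trans ?_
  have key := metric_connDiff hG.leviCivita.self_of_nhds hH.leviCivita.self_of_nhds
    (hG.contDiffAt.differentiableAt (by norm_num)) (hH.contDiffAt.differentiableAt (by norm_num))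
    a b x
  rw [← hx] at key
  have b1 := (abs_le.1 (h1 a b x)).2
  have b2 := (abs_le.1 (h1 b a x)).2
  have b3 := (abs_le.1 (h1 x a b)).1
  change _ ≤ 3 * δ * (N a * N b) * N x
  rw [key]
  linarith

/-- The same self-testing applied to `metric_covConn`. The three second-order terms contribute 3δ,
and the term with D, doubled, contributes 6δ after one factor δ ≤ 1 is dropped. -/
theorem gnorm_covConn_le (hδ1 : δ ≤ 1)
    (h2 : ∀ e w u v, |cov2 Γ (H - G) z e w u v| ≤
      δ * (gnorm (G z) e * gnorm (G z) w * gnorm (G z) u * gnorm (G z) v)) (e a b : V) :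
    gnorm (G z) (covConn Γ (Γ' - Γ) z e a b) ≤
      9 * δ * (gnorm (G z) e * gnorm (G z) a * gnorm (G z) b) := by
  have hD := gnorm_connDiff_le hG hH hle hδ0 h1 a b
  set N := gnorm (G z)
  have hN : ∀ u, 0 ≤ N u := gnorm_nonneg _
  have := hN e
  have := hN a
  have := hN b
  refine gnorm_le_of_apply_le (by positivity) ?_
  set x := covConn Γ (Γ' - Γ) z e a b with hx
  refine (hle x).trans ?_
  have := hN x
  have key := metric_covConn hG.leviCivita hH.leviCivita hG.contDiffAt hH.contDiffAt
    hG.differentiableAt_conn hH.differentiableAt_conn e a b x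
  rw [← hx] at key
  have b1 := (abs_le.1 (h2 e a b x)).2
  have b2 := (abs_le.1 (h2 e b a x)).2
  have b3 := (abs_le.1 (h2 e x a b)).1
  have b4 := (abs_le.1 (h1 e ((Γ' - Γ) z a b) x)).1
  have := hN ((Γ' - Γ) z a b)
  have b5 : δ * (N e * N ((Γ' - Γ) z a b) * N x) ≤ 3 * δ * (N e * N a * N b * N x) :=
    calc δ * (N e * N ((Γ' - Γ) z a b) * N x) ≤ 1 * (N e * (3 * δ * (N a * N b)) * N x) := by
          gcongr
      _ = _ := by ring
  change _ ≤ 9 * δ * (N e * N a * N b) * N x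
  rw [key]
  linarith

theorem abs_cov1_le (hδ1 : δ ≤ 1) {τ : ℝ} (hτ : 0 ≤ τ)
    (t0 : ∀ u v, |T z u v| ≤ τ * (gnorm (G z) u * gnorm (G z) v))
    (t1 : ∀ w u v, |cov1 Γ' T z w u v| ≤ τ * (gnorm (G z) w * gnorm (G z) u * gnorm (G z) v))
    (w u v : V) :
    |cov1 Γ T z w u v| ≤ 7 * τ * (gnorm (G z) w * gnorm (G z) u * gnorm (G z) v) := by
  have hD := gnorm_connDiff_le hG hH hle hδ0 h1
  set N := gnorm (G z)
  have hN : ∀ u, 0 ≤ N u := gnorm_nonneg _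
  have := hN w
  have := hN u
  have := hN v
  rw [cov1_connDiff (Γ' := Γ')]
  have b1 := t1 w u v
  have b2 : |T z ((Γ' - Γ) z w u) v| ≤ 3 * τ * (N w * N u * N v) :=
    calc _ ≤ τ * (N ((Γ' - Γ) z w u) * N v) := t0 _ _
      _ ≤ τ * ((3 * δ * (N w * N u)) * N v) := by gcongr; exact hD _ _
      _ ≤ τ * ((3 * 1 * (N w * N u)) * N v) := by gcongr
      _ = _ := by ring
  have b3 : |T z u ((Γ' - Γ) z w v)| ≤ 3 * τ * (N w * N u * N v) :=
    calc _ ≤ τ * (N u * N ((Γ' - Γ) z w v)) := t0 _ _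
      _ ≤ τ * (N u * (3 * δ * (N w * N v))) := by gcongr; exact hD _ _
      _ ≤ τ * (N u * (3 * 1 * (N w * N v))) := by gcongr
      _ = _ := by ring
  refine (abs_add_three _ _ _).trans ?_
  linarith

theorem abs_cov2_le (hδ1 : δ ≤ 1)
    (h2 : ∀ e w u v, |cov2 Γ (H - G) z e w u v| ≤
      δ * (gnorm (G z) e * gnorm (G z) w * gnorm (G z) u * gnorm (G z) v))
    (hT : ContDiffAt ℝ 2 T z) {τ : ℝ} (hτ : 0 ≤ τ)
    (t0 : ∀ u v, |T z u v| ≤ τ * (gnorm (G z) u * gnorm (G z) v))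
    (t1 : ∀ w u v, |cov1 Γ' T z w u v| ≤ τ * (gnorm (G z) w * gnorm (G z) u * gnorm (G z) v))
    (t2 : ∀ e w u v, |cov2 Γ' T z e w u v| ≤
      τ * (gnorm (G z) e * gnorm (G z) w * gnorm (G z) u * gnorm (G z) v))
    (e w u v : V) :
    |cov2 Γ T z e w u v| ≤
      70 * τ * (gnorm (G z) e * gnorm (G z) w * gnorm (G z) u * gnorm (G z) v) := by
  have hD := gnorm_connDiff_le hG hH hle hδ0 h1
  have hC := gnorm_covConn_le hG hH hle hδ0 h1 hδ1 h2
  have t1' := abs_cov1_le hG hH hle hδ0 h1 hδ1 hτ t0 t1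
  set N := gnorm (G z)
  have hN : ∀ u, 0 ≤ N u := gnorm_nonneg _
  have hD' : ∀ a b, N ((Γ' - Γ) z a b) ≤ 3 * (N a * N b) := by
    intro a b
    have := mul_nonneg (hN a) (hN b)
    refine (hD a b).trans ?_
    nlinarith
  have hC' : ∀ e a b, N (covConn Γ (Γ' - Γ) z e a b) ≤ 9 * (N e * N a * N b) := by
    intro e a b
    have := mul_nonneg (mul_nonneg (hN e) (hN a)) (hN b)
    refine (hC e a b).trans ?_
    nlinarith
  have := hN e
  have := hN w
  have := hN u
  have := hN v
  rw [cov2_connDiff hT hG.differentiableAt_conn hH.differentiableAt_conn]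
  have b0 := t2 e w u v
  have b1 : |cov1 Γ' T z ((Γ' - Γ) z e w) u v| ≤ 3 * τ * (N e * N w * N u * N v) :=
    calc _ ≤ τ * (N ((Γ' - Γ) z e w) * N u * N v) := t1 _ _ _
      _ ≤ τ * ((3 * (N e * N w)) * N u * N v) := by gcongr; exact hD' _ _
      _ = _ := by ring
  have b2 : |cov1 Γ' T z w ((Γ' - Γ) z e u) v| ≤ 3 * τ * (N e * N w * N u * N v) :=
    calc _ ≤ τ * (N w * N ((Γ' - Γ) z e u) * N v) := t1 _ _ _
      _ ≤ τ * (N w * (3 * (N e * N u)) * N v) := by gcongr; exact hD' _ _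
      _ = _ := by ring
  have b3 : |cov1 Γ' T z w u ((Γ' - Γ) z e v)| ≤ 3 * τ * (N e * N w * N u * N v) :=
    calc _ ≤ τ * (N w * N u * N ((Γ' - Γ) z e v)) := t1 _ _ _
      _ ≤ τ * (N w * N u * (3 * (N e * N v))) := by gcongr; exact hD' _ _
      _ = _ := by ring
  have b4 : |cov1 Γ T z e ((Γ' - Γ) z w u) v| ≤ 21 * τ * (N e * N w * N u * N v) :=
    calc _ ≤ 7 * τ * (N e * N ((Γ' - Γ) z w u) * N v) := t1' _ _ _
      _ ≤ 7 * τ * (N e * (3 * (N w * N u)) * N v) := by gcongr; exact hD' _ _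
      _ = _ := by ring
  have b5 : |T z (covConn Γ (Γ' - Γ) z e w u) v| ≤ 9 * τ * (N e * N w * N u * N v) :=
    calc _ ≤ τ * (N (covConn Γ (Γ' - Γ) z e w u) * N v) := t0 _ _
      _ ≤ τ * ((9 * (N e * N w * N u)) * N v) := by gcongr; exact hC' _ _ _
      _ = _ := by ring
  have b6 : |cov1 Γ T z e u ((Γ' - Γ) z w v)| ≤ 21 * τ * (N e * N w * N u * N v) :=
    calc _ ≤ 7 * τ * (N e * N u * N ((Γ' - Γ) z w v)) := t1' _ _ _
      _ ≤ 7 * τ * (N e * N u * (3 * (N w * N v))) := by gcongr; exact hD' _ _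
      _ = _ := by ring
  have b7 : |T z u (covConn Γ (Γ' - Γ) z e w v)| ≤ 9 * τ * (N e * N w * N u * N v) :=
    calc _ ≤ τ * (N u * N (covConn Γ (Γ' - Γ) z e w v)) := t0 _ _
      _ ≤ τ * (N u * (9 * (N e * N w * N v))) := by gcongr; exact hC' _ _ _
      _ = _ := by ring
  -- The constants add up as 1 + 3·3 + 2·21 + 2·9 = 70.
  rw [abs_le] at *
  constructor <;> linarith

end Bounds

end YamabeMap

namespace YamabeMap

/-! ### Simultaneous diagonalization, frames and tensor norms. -/

section LinearAlgebra

open Matrix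

variable {n : ℕ}

theorem exists_orthogonal_diagonalization {A : Matrix (Fin n) (Fin n) ℝ} (hA : A.IsHermitian) :
    ∃ U : Matrix (Fin n) (Fin n) ℝ, Uᵀ * U = 1 ∧ Uᵀ * A * U = diagonal hA.eigenvalues := by
  refine ⟨hA.eigenvectorUnitary, ?_, ?_⟩
  · have := Unitary.coe_star_mul_self hA.eigenvectorUnitary
    rwa [star_eq_conjTranspose, conjTranspose_eq_transpose_of_trivial] at this
  · have := hA.conjStarAlgAut_star_eigenvectorUnitary
    rw [Unitary.conjStarAlgAut_star_apply] at this
    rw [star_eq_conjTranspose, conjTranspose_eq_transpose_of_trivial] at this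
    exact this

/-- A positive definite matrix and a symmetric matrix can be diagonalized simultaneously. -/
theorem exists_simultaneous_diagonalization {A B : Matrix (Fin n) (Fin n) ℝ} (hA : A.PosDef)
    (hB : B.IsHermitian) :
    ∃ (P : Matrix (Fin n) (Fin n) ℝ) (l : Fin n → ℝ), Pᵀ * A * P = 1 ∧ Pᵀ * B * P = diagonal l := by
  obtain ⟨U, hU, hUA⟩ := exists_orthogonal_diagonalization hA.isHermitian
  set d := hA.isHermitian.eigenvalues with hd
  have hpos : ∀ i, 0 < d i := hA.eigenvalues_pos
  set S : Matrix (Fin n) (Fin n) ℝ := diagonal fun i => (√(d i))⁻¹ with hS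
  -- C turns A into the identity. Orthogonal changes of basis preserve the identity, so the
  -- transformed B can then be diagonalized on its own.
  set C := U * S with hC
  have hCA : Cᵀ * A * C = 1 := by
    have : Cᵀ * A * C = S * (Uᵀ * A * U) * S := by
      rw [hC, transpose_mul, hS, diagonal_transpose]
      simp only [Matrix.mul_assoc]
    rw [this, hUA, hS, diagonal_mul_diagonal, diagonal_mul_diagonal, ← diagonal_one]
    congr 1
    funext i
    have h1 := Real.sqrt_pos.2 (hpos i)
    field_simp
    rw [Real.sq_sqrt (hpos i).le]
  have hCB : (Cᵀ * B * C).IsHermitian := by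
    have := isHermitian_conjTranspose_mul_mul C hB
    rwa [conjTranspose_eq_transpose_of_trivial] at this
  obtain ⟨W, hW, hWB⟩ := exists_orthogonal_diagonalization hCB
  refine ⟨C * W, hCB.eigenvalues, ?_, ?_⟩
  · have : (C * W)ᵀ * A * (C * W) = Wᵀ * (Cᵀ * A * C) * W := by
      rw [transpose_mul]
      simp only [Matrix.mul_assoc]
    rw [this, hCA, Matrix.mul_one, hW]
  · have : (C * W)ᵀ * B * (C * W) = Wᵀ * (Cᵀ * B * C) * W := by
      rw [transpose_mul]
      simp only [Matrix.mul_assoc]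
    rw [this, hWB]

/-- The continuous bilinear form with a given Gram matrix. -/
noncomputable def bil : Matrix (Fin n) (Fin n) ℝ →ₗ[ℝ] Coord n →L[ℝ] Coord n →L[ℝ] ℝ where
  toFun A := ∑ i, ∑ j, A i j • ((EuclideanSpace.proj i : Coord n →L[ℝ] ℝ).smulRight
    (EuclideanSpace.proj j : Coord n →L[ℝ] ℝ))
  map_add' A B := by simp [add_smul, Finset.sum_add_distrib]
  map_smul' c A := by simp [mul_smul, Finset.smul_sum]

theorem bil_apply (A : Matrix (Fin n) (Fin n) ℝ) (u v : Coord n) :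
    bil A u v = ∑ i, ∑ j, A i j * (u i * v j) := by
  simp [bil]

theorem bil_single (A : Matrix (Fin n) (Fin n) ℝ) (i j : Fin n) :
    bil A (EuclideanSpace.single i 1) (EuclideanSpace.single j 1) = A i j := by
  simp [bil_apply, PiLp.single_apply]

theorem bil_eq_dotProduct (A : Matrix (Fin n) (Fin n) ℝ) (u v : Coord n) :
    bil A u v = (u : Fin n → ℝ) ⬝ᵥ A *ᵥ (v : Fin n → ℝ) := by
  simp only [bil_apply, dotProduct, mulVec, Finset.mul_sum]
  exact Finset.sum_congr rfl fun i _ => Finset.sum_congr rfl fun j _ => by ring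

/-- A basis `f` that is orthonormal for `A` and orthogonal for `B`. -/
structure IsFrame (A B : Matrix (Fin n) (Fin n) ℝ) (f : Fin n → Coord n) (l : Fin n → ℝ) :
    Prop where
  left : ∀ i j, bil A (f i) (f j) = if i = j then 1 else 0
  right : ∀ i j, bil B (f i) (f j) = if i = j then l i else 0
  inv_left : ∀ a b, A⁻¹ a b = ∑ i, f i a * f i b
  inv_right : (∀ i, l i ≠ 0) → ∀ a b, B⁻¹ a b = ∑ i, (l i)⁻¹ * (f i a * f i b)
  expand : ∀ x : Coord n, x = ∑ i, bil A x (f i) • f i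
  det_right : B.det = (∏ i, l i) * A.det

/-- The frame consists of the columns of the diagonalizing matrix P. From PᵀAP = 1 one reads off A⁻¹
= PPᵀ, and likewise B⁻¹ = P diag(1/l) Pᵀ. -/
theorem exists_isFrame {A B : Matrix (Fin n) (Fin n) ℝ} (hA : A.PosDef) (hB : B.IsHermitian) :
    ∃ f l, IsFrame A B f l := by
  obtain ⟨P, l, hPA, hPB⟩ := exists_simultaneous_diagonalization hA hB
  have hPA' : P * (Pᵀ * A) = 1 := mul_eq_one_comm.1 hPA
  have hPA'' : (P * Pᵀ) * A = 1 := by rw [Matrix.mul_assoc, hPA']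
  have hA' : Aᵀ = A := by
    simpa [conjTranspose_eq_transpose_of_trivial] using hA.isHermitian.eq
  have hinv : A⁻¹ = P * Pᵀ := inv_eq_left_inv hPA''
  have hgram : ∀ (C : Matrix (Fin n) (Fin n) ℝ) i j,
      bil C (WithLp.toLp 2 fun a => P a i) (WithLp.toLp 2 fun a => P a j) = (Pᵀ * C * P) i j := by
    intro C i j
    rw [bil_eq_dotProduct, Matrix.mul_assoc, Matrix.mul_apply]
    simp only [dotProduct, mulVec, transpose_apply, Matrix.mul_apply]
  refine ⟨fun i => WithLp.toLp 2 fun a => P a i, l, ?_, ?_, ?_, ?_, ?_, ?_⟩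
  · intro i j
    rw [hgram, hPA, one_apply]
  · intro i j
    rw [hgram, hPB, diagonal_apply]
  · intro a b
    rw [hinv, Matrix.mul_apply]
    rfl
  · intro hl a b
    have h1 : Pᵀ * B = diagonal l * (Pᵀ * A) := by
      rw [← hPB, Matrix.mul_assoc (Pᵀ * B), hPA', Matrix.mul_one]
    have h2 : (P * diagonal (fun i => (l i)⁻¹) * Pᵀ) * B = 1 := by
      rw [Matrix.mul_assoc, h1, Matrix.mul_assoc, ← Matrix.mul_assoc (diagonal _) (diagonal l),
        diagonal_mul_diagonal]
      have : (diagonal fun i => (l i)⁻¹ * l i : Matrix (Fin n) (Fin n) ℝ) = 1 := by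
        rw [← diagonal_one]
        congr 1
        funext i
        exact inv_mul_cancel₀ (hl i)
      rw [this, Matrix.one_mul, hPA']
    rw [inv_eq_left_inv h2, Matrix.mul_apply]
    refine Finset.sum_congr rfl fun i _ => ?_
    rw [mul_diagonal, transpose_apply]
    ring
  · intro x
    ext a
    have h3 : (x : Fin n → ℝ) = P *ᵥ (Pᵀ *ᵥ (A *ᵥ (x : Fin n → ℝ))) := by
      rw [mulVec_mulVec, mulVec_mulVec, hPA'', one_mulVec]
    have h4 : ∀ i, bil A x (WithLp.toLp 2 fun a => P a i) = (Pᵀ *ᵥ (A *ᵥ (x : Fin n → ℝ))) i := by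
      intro i
      rw [bil_eq_dotProduct, dotProduct_mulVec, ← mulVec_transpose, hA', dotProduct_comm]
      rfl
    simp only [h4, WithLp.ofLp_sum, Finset.sum_apply, WithLp.ofLp_smul,
      Pi.smul_apply, smul_eq_mul]
    rw [congrFun h3 a]
    simp only [mulVec, dotProduct]
    exact Finset.sum_congr rfl fun i _ => mul_comm _ _
  · have d1 := congrArg det hPA
    have d2 := congrArg det hPB
    simp only [det_mul, det_transpose, det_one, det_diagonal] at d1 d2
    rw [← d2]
    linear_combination (-B.det) * d1

theorem IsFrame.gnorm_self {A B : Matrix (Fin n) (Fin n) ℝ} {f l} (h : IsFrame A B f l)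
    (i : Fin n) : gnorm (bil A) (f i) = 1 := by
  simp [gnorm, h.left]

theorem IsFrame.sum_sq {A B : Matrix (Fin n) (Fin n) ℝ} {f l} (h : IsFrame A B f l)
    (x : Coord n) : bil A x x = ∑ i, bil A x (f i) ^ 2 := by
  conv_lhs => enter [2]; rw [h.expand x]
  simp [pow_two]

theorem IsFrame.gnorm_eq {A B : Matrix (Fin n) (Fin n) ℝ} {f l} (h : IsFrame A B f l)
    (x : Coord n) : gnorm (bil A) x = √(∑ i, bil A x (f i) ^ 2) := by
  rw [gnorm, h.sum_sq]

theorem IsFrame.abs_bil_le {A B : Matrix (Fin n) (Fin n) ℝ} {f l} (h : IsFrame A B f l)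
    (x : Coord n) (i : Fin n) : |bil A x (f i)| ≤ gnorm (bil A) x := by
  rw [h.gnorm_eq]
  refine Real.abs_le_sqrt ?_
  exact Finset.single_le_sum (f := fun i => bil A x (f i) ^ 2) (fun _ _ => sq_nonneg _)
    (Finset.mem_univ i)

/-- The components of a multilinear form with respect to the standard basis. -/
noncomputable def components {m : ℕ} (T : MultilinearMap ℝ (fun _ : Fin m => Coord n) ℝ) (I : Fin m → Fin n) : ℝ :=
  T fun r => EuclideanSpace.single (I r) 1

theorem multilinear_apply_eq_sum {m : ℕ} (T : MultilinearMap ℝ (fun _ : Fin m => Coord n) ℝ)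
    (u : Fin m → Coord n) : T u = ∑ I, (∏ r, u r (I r)) * components T I := by
  have hu : u = fun r => ∑ i, u r i • (EuclideanSpace.single i (1 : ℝ) : Coord n) := by
    funext r
    ext a
    simp [Pi.single_apply]
  conv_lhs => rw [hu]
  rw [MultilinearMap.map_sum]
  refine Finset.sum_congr rfl fun I _ => ?_
  rw [MultilinearMap.map_smul_univ]
  rfl

/-- Since A⁻¹ = ∑ fᵢ ⊗ fᵢ, the double contraction defining `tensorNorm` factors into squares of the
values on frame vectors. -/
theorem IsFrame.tensorNorm_eq {A B : Matrix (Fin n) (Fin n) ℝ} {f l} (h : IsFrame A B f l) {m : ℕ}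
    (T : MultilinearMap ℝ (fun _ : Fin m => Coord n) ℝ) :
    tensorNorm A (components T) = √(∑ K : Fin m → Fin n, T (fun r => f (K r)) ^ 2) := by
  unfold tensorNorm
  congr 1
  have h1 : ∀ I J : Fin m → Fin n, ∏ r, A⁻¹ (I r) (J r)
      = ∑ K : Fin m → Fin n, (∏ r, f (K r) (I r)) * ∏ r, f (K r) (J r) := by
    intro I J
    simp only [h.inv_left]
    rw [Finset.prod_univ_sum]
    simp only [Fintype.piFinset_univ, Finset.prod_mul_distrib]
  simp only [h1, multilinear_apply_eq_sum T (fun r => f _), pow_two, Finset.sum_mul, Finset.mul_sum]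
  calc _ = ∑ I, ∑ K : Fin m → Fin n, ∑ J, (∏ r, f (K r) (I r)) * (∏ r, f (K r) (J r)) *
        components T I * components T J := by
        refine Finset.sum_congr rfl fun I _ => ?_
        rw [Finset.sum_comm]
    _ = ∑ K : Fin m → Fin n, ∑ I, ∑ J, (∏ r, f (K r) (I r)) * (∏ r, f (K r) (J r)) *
        components T I * components T J := Finset.sum_comm
    _ = _ := by
        refine Finset.sum_congr rfl fun K _ => ?_
        rw [Finset.sum_comm]
        refine Finset.sum_congr rfl fun I _ => Finset.sum_congr rfl fun J _ => ?_
        ring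

/-- Expand every argument in the frame and apply Cauchy–Schwarz. The sum of squares of the products
of coefficients is the product of the squared lengths. -/
theorem IsFrame.abs_multilinear_le {A B : Matrix (Fin n) (Fin n) ℝ} {f l} (h : IsFrame A B f l)
    {m : ℕ} (T : MultilinearMap ℝ (fun _ : Fin m => Coord n) ℝ) (u : Fin m → Coord n) :
    |T u| ≤ tensorNorm A (components T) * ∏ r, gnorm (bil A) (u r) := by
  have hT : T u = ∑ K : Fin m → Fin n, (∏ r, bil A (u r) (f (K r))) * T (fun r => f (K r)) := by
    conv_lhs => rw [show u = fun r => ∑ i, bil A (u r) (f i) • f i from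
      funext fun r => h.expand (u r)]
    rw [MultilinearMap.map_sum]
    exact Finset.sum_congr rfl fun I _ => MultilinearMap.map_smul_univ _ _ _
  have hN : ∏ r, gnorm (bil A) (u r) = √(∑ K : Fin m → Fin n, (∏ r, bil A (u r) (f (K r))) ^ 2) := by
    simp only [h.gnorm_eq]
    rw [← Real.sqrt_prod _ (fun i _ => Finset.sum_nonneg fun _ _ => sq_nonneg _),
      Finset.prod_univ_sum]
    simp [Finset.prod_pow]
  rw [h.tensorNorm_eq, hN, ← Real.sqrt_mul (Finset.sum_nonneg fun _ _ => sq_nonneg _), hT, mul_comm]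
  refine Real.abs_le_sqrt ?_
  exact Finset.sum_mul_sq_le_sq_mul_sq _ _ _

theorem IsFrame.tensorNorm_le {A B : Matrix (Fin n) (Fin n) ℝ} {f l} (h : IsFrame A B f l) {m : ℕ}
    (T : MultilinearMap ℝ (fun _ : Fin m => Coord n) ℝ) {K : ℝ} (hK : 0 ≤ K)
    (hT : ∀ u, |T u| ≤ K * ∏ r, gnorm (bil A) (u r)) :
    tensorNorm A (components T) ≤ √(n ^ m) * K := by
  rw [h.tensorNorm_eq, ← Real.sqrt_sq hK, ← Real.sqrt_mul (by positivity)]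
  refine Real.sqrt_le_sqrt ?_
  calc ∑ I : Fin m → Fin n, T (fun r => f (I r)) ^ 2 ≤ ∑ I : Fin m → Fin n, K ^ 2 := by
        refine Finset.sum_le_sum fun I _ => ?_
        rw [← sq_abs (T _)]
        have := hT fun r => f (I r)
        simp only [h.gnorm_self, Finset.prod_const_one, mul_one] at this
        gcongr
    _ = _ := by simp

end LinearAlgebra

end YamabeMap

namespace YamabeMap

/-! ### Covariant derivatives bundled as multilinear forms, so that tensor norms apply to them. -/

section Multilinear

variable {V : Type*} [NormedAddCommGroup V] [NormedSpace ℝ V]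

/-- A bilinear form as a multilinear map on `Fin 2`. -/
noncomputable def multilinear₂ (F : V → V → ℝ) (h0 : ∀ b, IsLinearMap ℝ fun a => F a b)
    (h1 : ∀ a, IsLinearMap ℝ fun b => F a b) : MultilinearMap ℝ (fun _ : Fin 2 => V) ℝ :=
  MultilinearMap.mk' (fun u => F (u 0) (u 1))
    (by
      intro u i x y
      fin_cases i
      · simpa [Function.update] using (h0 _).map_add x y
      · simpa [Function.update] using (h1 _).map_add x y)
    (by
      intro u i c x
      fin_cases i
      · simpa [Function.update] using (h0 _).map_smul c x
      · simpa [Function.update] using (h1 _).map_smul c x)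

/-- A trilinear form as a multilinear map on `Fin 3`. -/
noncomputable def multilinear₃ (F : V → V → V → ℝ) (h0 : ∀ b c, IsLinearMap ℝ fun a => F a b c)
    (h1 : ∀ a c, IsLinearMap ℝ fun b => F a b c) (h2 : ∀ a b, IsLinearMap ℝ fun c => F a b c) :
    MultilinearMap ℝ (fun _ : Fin 3 => V) ℝ :=
  MultilinearMap.mk' (fun u => F (u 0) (u 1) (u 2))
    (by
      intro u i x y
      fin_cases i
      · simpa [Function.update] using (h0 _ _).map_add x y
      · simpa [Function.update] using (h1 _ _).map_add x y
      · simpa [Function.update] using (h2 _ _).map_add x y)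
    (by
      intro u i c x
      fin_cases i
      · simpa [Function.update] using (h0 _ _).map_smul c x
      · simpa [Function.update] using (h1 _ _).map_smul c x
      · simpa [Function.update] using (h2 _ _).map_smul c x)

/-- A quadrilinear form as a multilinear map on `Fin 4`. -/
noncomputable def multilinear₄ (F : V → V → V → V → ℝ) (h0 : ∀ b c d, IsLinearMap ℝ fun a => F a b c d)
    (h1 : ∀ a c d, IsLinearMap ℝ fun b => F a b c d)
    (h2 : ∀ a b d, IsLinearMap ℝ fun c => F a b c d)
    (h3 : ∀ a b c, IsLinearMap ℝ fun d => F a b c d) :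
    MultilinearMap ℝ (fun _ : Fin 4 => V) ℝ :=
  MultilinearMap.mk' (fun u => F (u 0) (u 1) (u 2) (u 3))
    (by
      intro u i x y
      fin_cases i
      · simpa [Function.update] using (h0 _ _ _).map_add x y
      · simpa [Function.update] using (h1 _ _ _).map_add x y
      · simpa [Function.update] using (h2 _ _ _).map_add x y
      · simpa [Function.update] using (h3 _ _ _).map_add x y)
    (by
      intro u i c x
      fin_cases i
      · simpa [Function.update] using (h0 _ _ _).map_smul c x
      · simpa [Function.update] using (h1 _ _ _).map_smul c x
      · simpa [Function.update] using (h2 _ _ _).map_smul c x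
      · simpa [Function.update] using (h3 _ _ _).map_smul c x)

variable {T : V → V →L[ℝ] V →L[ℝ] ℝ} {Γ : V → V →L[ℝ] V →L[ℝ] V} {z : V}

/-- A bilinear form as a multilinear map. -/
noncomputable def bilMultilinear (B : V →L[ℝ] V →L[ℝ] ℝ) : MultilinearMap ℝ (fun _ : Fin 2 => V) ℝ :=
  multilinear₂ (fun u v => B u v) (fun b => ⟨by simp, by simp⟩) (fun a => ⟨by simp, by simp⟩)

theorem bilMultilinear_apply (B : V →L[ℝ] V →L[ℝ] ℝ) (u : Fin 2 → V) :
    bilMultilinear B u = B (u 0) (u 1) := rfl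

theorem isLinearMap_cov1₀ (b c : V) : IsLinearMap ℝ fun a => cov1 Γ T z a b c :=
  ⟨fun x y => by simp [cov1]; ring, fun r x => by simp [cov1]; ring⟩

theorem isLinearMap_cov1₁ (a c : V) : IsLinearMap ℝ fun b => cov1 Γ T z a b c :=
  ⟨fun x y => by simp [cov1]; ring, fun r x => by simp [cov1]; ring⟩

theorem isLinearMap_cov1₂ (a b : V) : IsLinearMap ℝ fun c => cov1 Γ T z a b c :=
  ⟨fun x y => by simp [cov1]; ring, fun r x => by simp [cov1]; ring⟩

/-- The first covariant derivative at a point as a multilinear map. -/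
noncomputable def cov1Multilinear (Γ : V → V →L[ℝ] V →L[ℝ] V) (T : V → V →L[ℝ] V →L[ℝ] ℝ) (z : V) :
    MultilinearMap ℝ (fun _ : Fin 3 => V) ℝ :=
  multilinear₃ (cov1 Γ T z)
    isLinearMap_cov1₀ isLinearMap_cov1₁ isLinearMap_cov1₂

theorem cov1Multilinear_apply (u : Fin 3 → V) :
    cov1Multilinear Γ T z u = cov1 Γ T z (u 0) (u 1) (u 2) := rfl

/-- The second covariant derivative at a point as a multilinear map. -/
noncomputable def cov2Multilinear (Γ : V → V →L[ℝ] V →L[ℝ] V) (T : V → V →L[ℝ] V →L[ℝ] ℝ) (z : V)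
    (hT : ContDiffAt ℝ 2 T z) (hΓ : DifferentiableAt ℝ Γ z) :
    MultilinearMap ℝ (fun _ : Fin 4 => V) ℝ :=
  have hd := ContDiffAt.cov1_differentiableAt hT hΓ
  multilinear₄ (cov2 Γ T z)
    (fun b c d => ⟨fun x y => by
      simp only [cov2, map_add, add_apply, (isLinearMap_cov1₀ _ _).map_add,
        (isLinearMap_cov1₁ _ _).map_add, (isLinearMap_cov1₂ _ _).map_add]; ring,
      fun r x => by
      simp only [cov2, map_smul, smul_apply, (isLinearMap_cov1₀ _ _).map_smul,
        (isLinearMap_cov1₁ _ _).map_smul, (isLinearMap_cov1₂ _ _).map_smul, smul_eq_mul]; ring⟩)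
    (fun a c d => ⟨fun x y => by
      simp only [cov2, map_add, (isLinearMap_cov1₀ _ _).map_add]
      rw [fderiv_fun_add (hd _ _ _) (hd _ _ _), add_apply]
      ring,
      fun r x => by
      simp only [cov2, map_smul, (isLinearMap_cov1₀ _ _).map_smul, smul_eq_mul]
      rw [fderiv_const_mul (hd _ _ _), smul_apply, smul_eq_mul]
      ring⟩)
    (fun a b d => ⟨fun x y => by
      simp only [cov2, map_add, (isLinearMap_cov1₁ _ _).map_add]
      rw [fderiv_fun_add (hd _ _ _) (hd _ _ _), add_apply]
      ring,
      fun r x => by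
      simp only [cov2, map_smul, (isLinearMap_cov1₁ _ _).map_smul, smul_eq_mul]
      rw [fderiv_const_mul (hd _ _ _), smul_apply, smul_eq_mul]
      ring⟩)
    (fun a b c => ⟨fun x y => by
      simp only [cov2, map_add, (isLinearMap_cov1₂ _ _).map_add]
      rw [fderiv_fun_add (hd _ _ _) (hd _ _ _), add_apply]
      ring,
      fun r x => by
      simp only [cov2, map_smul, (isLinearMap_cov1₂ _ _).map_smul, smul_eq_mul]
      rw [fderiv_const_mul (hd _ _ _), smul_apply, smul_eq_mul]
      ring⟩)

theorem cov2Multilinear_apply (hT : ContDiffAt ℝ 2 T z) (hΓ : DifferentiableAt ℝ Γ z)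
    (u : Fin 4 → V) :
    cov2Multilinear Γ T z hT hΓ u = cov2 Γ T z (u 0) (u 1) (u 2) (u 3) := rfl

theorem cov2_add {S : V → V →L[ℝ] V →L[ℝ] ℝ} (hT : ContDiffAt ℝ 2 T z) (hS : ContDiffAt ℝ 2 S z)
    (hΓ : DifferentiableAt ℝ Γ z) (e w u v : V) :
    cov2 Γ (T + S) z e w u v = cov2 Γ T z e w u v + cov2 Γ S z e w u v := by
  have hev : (fun z => cov1 Γ (T + S) z w u v) =ᶠ[𝓝 z]
      fun z => cov1 Γ T z w u v + cov1 Γ S z w u v := by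
    filter_upwards [hT.eventually (by simp), hS.eventually (by simp)] with z h1 h2
    exact cov1_add (h1.differentiableAt (by norm_num)) (h2.differentiableAt (by norm_num)) _ _ _
  have h1 := cov1_add (Γ := Γ) (hT.differentiableAt (by norm_num)) (hS.differentiableAt (by norm_num))
  unfold cov2
  rw [hev.fderiv_eq, fderiv_fun_add (ContDiffAt.cov1_differentiableAt hT hΓ _ _ _)
    (ContDiffAt.cov1_differentiableAt hS hΓ _ _ _)]
  simp only [h1, add_apply]
  ring

/-- The vector-valued curvature form is linear in its last argument. -/
noncomputable def curvLinear (Γ : V → V →L[ℝ] V →L[ℝ] V) (z u v : V) : V →ₗ[ℝ] V where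
  toFun w := curvVec Γ z u v w
  map_add' x y := by simp [curvVec]; abel
  map_smul' r x := by simp [curvVec, smul_sub, smul_add]

end Multilinear

/-! ### Multilinear forms, traces and the Ricci tensor on coordinate space. -/

section Coordinates

variable {n : ℕ}

theorem multilinear_ext_components {m : ℕ} {S T : MultilinearMap ℝ (fun _ : Fin m => Coord n) ℝ}
    (h : ∀ I, components S I = components T I) : S = T := by
  ext u
  rw [multilinear_apply_eq_sum, multilinear_apply_eq_sum]
  simp only [h]

/-- The Ricci tensor of a connection. -/
noncomputable def ricciMultilinear (Γ : Coord n → Coord n →L[ℝ] Coord n →L[ℝ] Coord n) (z : Coord n) :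
    MultilinearMap ℝ (fun _ : Fin 2 => Coord n) ℝ :=
  multilinear₂ (fun u v => ∑ c, curvVec Γ z u v (EuclideanSpace.single c 1) c)
    (fun b => ⟨fun x y => by
      rw [← Finset.sum_add_distrib]
      exact Finset.sum_congr rfl fun c _ => by simp [curvVec]; ring,
      fun r x => by
      rw [smul_eq_mul, Finset.mul_sum]
      exact Finset.sum_congr rfl fun c _ => by simp [curvVec]; ring⟩)
    (fun b => ⟨fun x y => by
      rw [← Finset.sum_add_distrib]
      exact Finset.sum_congr rfl fun c _ => by simp [curvVec]; ring,
      fun r x => by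
      rw [smul_eq_mul, Finset.mul_sum]
      exact Finset.sum_congr rfl fun c _ => by simp [curvVec]; ring⟩)

/-- A trace is independent of the basis, and the coordinates dual to an A-orthonormal frame are x ↦
A(x, fⱼ). This moves the Ricci trace from the coordinate basis to the frame. -/
theorem IsFrame.trace_eq {A B : Matrix (Fin n) (Fin n) ℝ} {f l} (h : IsFrame A B f l)
    (L : Coord n →ₗ[ℝ] Coord n) :
    ∑ c, L (EuclideanSpace.single c 1) c = ∑ j, bil A (L (f j)) (f j) := by
  have h1 : ∀ j, bil A (L (f j)) (f j)
      = ∑ c, bil A (L (EuclideanSpace.single c 1)) (f j) * f j c := by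
    intro j
    have h2 : f j = ∑ c, f j c • (EuclideanSpace.single c (1 : ℝ) : Coord n) := by
      ext a
      simp [Pi.single_apply]
    conv_lhs => enter [1, 2, 2]; rw [h2]
    simp [mul_comm]
  simp only [h1]
  rw [Finset.sum_comm]
  refine Finset.sum_congr rfl fun c _ => ?_
  conv_lhs => rw [h.expand (L (EuclideanSpace.single c 1))]
  simp

theorem IsFrame.ricci_eq {A B : Matrix (Fin n) (Fin n) ℝ} {f l} (h : IsFrame A B f l)
    (Γ : Coord n → Coord n →L[ℝ] Coord n →L[ℝ] Coord n) (z : Coord n) (u : Fin 2 → Coord n) :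
    ricciMultilinear Γ z u = ∑ j, bil A (curvVec Γ z (u 0) (u 1) (f j)) (f j) :=
  h.trace_eq (curvLinear Γ z (u 0) (u 1))

end Coordinates

end YamabeMap

namespace YamabeMap

/-! ### Identification of the index formulas with the coordinate-free objects. -/

section Coordinates

variable {n : ℕ} {G H B : Coord n → Matrix (Fin n) (Fin n) ℝ} {U : Set (Coord n)} {y : Coord n}

/-- A smooth Riemannian metric, in coordinates, on an open set. -/
structure IsMetricOn (G : Coord n → Matrix (Fin n) (Fin n) ℝ) (U : Set (Coord n)) : Prop where
  isOpen : IsOpen U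
  contDiffOn : ∀ i j, ContDiffOn ℝ ∞ (fun y => G y i j) U
  posDef : ∀ y ∈ U, (G y).PosDef

theorem ContDiffOn.det_matrix (hB : ∀ i j, ContDiffOn ℝ ∞ (fun y => B y i j) U) :
    ContDiffOn ℝ ∞ (fun y => (B y).det) U := by
  simp only [Matrix.det_apply]
  refine ContDiffOn.sum fun σ _ => ?_
  refine ContDiffOn.const_smul _ ?_
  exact contDiffOn_prod fun i _ => hB _ _

theorem ContDiffOn.pderiv {f : Coord n → ℝ} (hU : IsOpen U) (hf : ContDiffOn ℝ ∞ f U) (i : Fin n) :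
    ContDiffOn ℝ ∞ (pderiv i f) U :=
  (hf.fderiv_of_isOpen hU (m := ∞) (by simp)).clm_apply contDiffOn_const

/-- Cramer's rule: the entries are cofactors divided by a nonvanishing determinant. -/
theorem IsMetricOn.contDiffOn_inv (hG : IsMetricOn G U) (i j : Fin n) :
    ContDiffOn ℝ ∞ (fun y => (G y)⁻¹ i j) U := by
  have h1 : ContDiffOn ℝ ∞ (fun y => (G y).det⁻¹ * (G y).adjugate i j) U := by
    refine ((ContDiffOn.det_matrix hG.contDiffOn).inv fun y hy => (hG.posDef y hy).det_pos.ne').mul ?_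
    simp only [Matrix.adjugate_apply]
    refine ContDiffOn.det_matrix fun a b => ?_
    by_cases h : a = j
    · subst h
      simp only [Matrix.updateRow_self]
      exact contDiffOn_const
    · simp only [Matrix.updateRow_ne h]
      exact hG.contDiffOn a b
  refine h1.congr fun y _ => ?_
  simp [Matrix.inv_def]

theorem IsMetricOn.contDiffOn_christoffel (hG : IsMetricOn G U) (a b c : Fin n) :
    ContDiffOn ℝ ∞ (christoffel G a b c) U := by
  have hp : ∀ i j k, ContDiffOn ℝ ∞ (fun y => YamabeMap.pderiv i (fun z => G z j k) y) U :=
    fun i j k => ContDiffOn.pderiv hG.isOpen (hG.contDiffOn j k) i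
  unfold christoffel
  refine contDiffOn_const.mul (ContDiffOn.sum fun m _ => ?_)
  exact (hG.contDiffOn_inv c m).mul (((hp _ _ _).add (hp _ _ _)).sub (hp _ _ _))

theorem IsMetricOn.contDiffOn_ricciCoeff (hG : IsMetricOn G U) (a b : Fin n) :
    ContDiffOn ℝ ∞ (ricciCoeff G a b) U := by
  have hc := hG.contDiffOn_christoffel
  unfold ricciCoeff
  refine ContDiffOn.sum fun c _ => ?_
  refine (((ContDiffOn.pderiv hG.isOpen (hc _ _ _) _).sub
    (ContDiffOn.pderiv hG.isOpen (hc _ _ _) _)).add ?_).sub ?_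
  · exact ContDiffOn.sum fun d _ => (hc _ _ _).mul (hc _ _ _)
  · exact ContDiffOn.sum fun d _ => (hc _ _ _).mul (hc _ _ _)

theorem IsMetricOn.contDiffOn_scalCoeff (hG : IsMetricOn G U) : ContDiffOn ℝ ∞ (scalCoeff G) U := by
  unfold scalCoeff
  exact ContDiffOn.sum fun a _ => ContDiffOn.sum fun b _ =>
    (hG.contDiffOn_inv a b).mul (hG.contDiffOn_ricciCoeff a b)

theorem IsMetricOn.continuousOn_tensorNorm (hG : IsMetricOn G U) {m : ℕ}
    {T : Coord n → (Fin m → Fin n) → ℝ} (hT : ∀ I, ContinuousOn (fun y => T y I) U) :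
    ContinuousOn (fun y => tensorNorm (G y) (T y)) U := by
  unfold tensorNorm
  refine ContinuousOn.sqrt ?_
  refine continuousOn_finsetSum _ fun I _ => continuousOn_finsetSum _ fun J _ => ?_
  refine (ContinuousOn.mul ?_ (hT I)).mul (hT J)
  exact continuousOn_finsetProd _ fun r _ => (hG.contDiffOn_inv _ _).continuousOn

theorem contDiffOn_bil (hB : ∀ i j, ContDiffOn ℝ ∞ (fun y => B y i j) U) :
    ContDiffOn ℝ ∞ (fun y => bil (B y)) U := by
  simp only [bil, LinearMap.coe_mk, AddHom.coe_mk]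
  exact ContDiffOn.sum fun i _ => ContDiffOn.sum fun j _ => (hB i j).smul contDiffOn_const

theorem fderiv_bil (hB : ∀ i j, DifferentiableAt ℝ (fun y => B y i j) y) (w : Coord n) :
    fderiv ℝ (fun y => bil (B y)) y w = bil (Matrix.of fun i j => fderiv ℝ (fun y => B y i j) y w) := by
  simp only [bil, LinearMap.coe_mk, AddHom.coe_mk, Matrix.of_apply]
  rw [fderiv_fun_sum fun i _ => by fun_prop]
  simp only [FunLike.coe_sum, Finset.sum_apply]
  refine Finset.sum_congr rfl fun i _ => ?_
  rw [fderiv_fun_sum fun j _ => by fun_prop]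
  simp only [FunLike.coe_sum, Finset.sum_apply]
  refine Finset.sum_congr rfl fun j _ => ?_
  rw [fderiv_smul_const (hB i j)]
  simp

theorem fderiv_bil_single (hB : ∀ i j, DifferentiableAt ℝ (fun y => B y i j) y) (a i j : Fin n) :
    fderiv ℝ (fun y => bil (B y)) y (EuclideanSpace.single a 1) (EuclideanSpace.single i 1)
      (EuclideanSpace.single j 1) = pderiv a (fun z => B z i j) y := by
  rw [fderiv_bil hB, bil_single]
  rfl

/-- The Levi-Civita connection of a metric, as a field of bilinear maps. -/
noncomputable def conn (G : Coord n → Matrix (Fin n) (Fin n) ℝ) (y : Coord n) :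
    Coord n →L[ℝ] Coord n →L[ℝ] Coord n :=
  ∑ a, ∑ b, ∑ c, christoffel G a b c y • (EuclideanSpace.proj a : Coord n →L[ℝ] ℝ).smulRight
    ((EuclideanSpace.proj b : Coord n →L[ℝ] ℝ).smulRight
      (EuclideanSpace.single c (1 : ℝ) : Coord n))

theorem conn_apply (u v : Coord n) (c : Fin n) :
    conn G y u v c = ∑ a, ∑ b, christoffel G a b c y * (u a * v b) := by
  simp [conn, Pi.single_apply]

theorem conn_single (a b c : Fin n) :
    conn G y (EuclideanSpace.single a 1) (EuclideanSpace.single b 1) c = christoffel G a b c y := by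
  simp [conn_apply]

theorem conn_single_eq_sum (a b : Fin n) :
    conn G y (EuclideanSpace.single a 1) (EuclideanSpace.single b 1) =
      ∑ c, christoffel G a b c y • (EuclideanSpace.single c (1 : ℝ) : Coord n) := by
  ext c
  rw [conn_single]
  simp [Pi.single_apply]

theorem IsMetricOn.contDiffOn_conn (hG : IsMetricOn G U) : ContDiffOn ℝ ∞ (conn G) U := by
  unfold conn
  exact ContDiffOn.sum fun a _ => ContDiffOn.sum fun b _ => ContDiffOn.sum fun c _ =>
    (hG.contDiffOn_christoffel a b c).smul contDiffOn_const

theorem IsMetricOn.differentiableAt (hG : IsMetricOn G U) (hy : y ∈ U) (i j : Fin n) :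
    DifferentiableAt ℝ (fun y => G y i j) y :=
  ((hG.contDiffOn i j).contDiffAt (hG.isOpen.mem_nhds hy)).differentiableAt (by simp)

theorem IsMetricOn.symm (hG : IsMetricOn G U) (hy : y ∈ U) (i j : Fin n) : G y i j = G y j i := by
  simpa using (hG.posDef y hy).isHermitian.apply j i

theorem IsMetricOn.pderiv_symm (hG : IsMetricOn G U) (hy : y ∈ U) (a i j : Fin n) :
    YamabeMap.pderiv a (fun z => G z i j) y = YamabeMap.pderiv a (fun z => G z j i) y := by
  have : (fun z => G z i j) =ᶠ[𝓝 y] fun z => G z j i := by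
    filter_upwards [hG.isOpen.mem_nhds hy] with z hz using hG.symm hz i j
  unfold YamabeMap.pderiv
  rw [this.fderiv_eq]

theorem IsMetricOn.christoffel_symm (hG : IsMetricOn G U) (hy : y ∈ U) (a b c : Fin n) :
    christoffel G a b c y = christoffel G b a c y := by
  unfold christoffel
  congr 1
  refine Finset.sum_congr rfl fun m _ => ?_
  rw [hG.pderiv_symm hy m a b]
  ring

/-- Lowering the upper index cancels the inverse matrix in `christoffel` and leaves the Koszul
expression on basis vectors. -/
theorem IsMetricOn.sum_mul_christoffel (hG : IsMetricOn G U) (hy : y ∈ U) (a b k : Fin n) :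
    ∑ c, christoffel G a b c y * G y c k = (1 / 2) * (YamabeMap.pderiv a (fun z => G z b k) y
      + YamabeMap.pderiv b (fun z => G z a k) y - YamabeMap.pderiv k (fun z => G z a b) y) := by
  have hdet : IsUnit (G y).det := (hG.posDef y hy).det_pos.ne'.isUnit
  have h1 : ∀ m, ∑ c, G y k c * (G y)⁻¹ c m = (1 : Matrix (Fin n) (Fin n) ℝ) k m := by
    intro m
    rw [← Matrix.mul_apply, Matrix.mul_nonsing_inv _ hdet]
  unfold christoffel
  set F : Fin n → ℝ := fun m => YamabeMap.pderiv a (fun z => G z b m) y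
    + YamabeMap.pderiv b (fun z => G z a m) y - YamabeMap.pderiv m (fun z => G z a b) y with hF
  calc ∑ c, (1 / 2) * (∑ m, (G y)⁻¹ c m * F m) * G y c k
      = ∑ c, ∑ m, (1 / 2) * ((G y k c * (G y)⁻¹ c m) * F m) := by
        refine Finset.sum_congr rfl fun c _ => ?_
        rw [Finset.mul_sum, Finset.sum_mul]
        refine Finset.sum_congr rfl fun m _ => ?_
        rw [hG.symm hy c k]
        ring
    _ = ∑ m, (1 / 2) * ((∑ c, G y k c * (G y)⁻¹ c m) * F m) := by
        rw [Finset.sum_comm]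
        refine Finset.sum_congr rfl fun m _ => ?_
        rw [Finset.sum_mul, Finset.mul_sum]
    _ = (1 / 2) * F k := by
        simp [h1, Matrix.one_apply]

theorem bil_symm {A : Matrix (Fin n) (Fin n) ℝ} (hA : ∀ i j, A i j = A j i) (u v : Coord n) :
    bil A u v = bil A v u := by
  rw [bil_apply, bil_apply, Finset.sum_comm]
  exact Finset.sum_congr rfl fun i _ => Finset.sum_congr rfl fun j _ => by rw [hA j i]; ring

theorem IsMetricOn.isLeviCivitaAt (hG : IsMetricOn G U) (hy : y ∈ U) :
    IsLeviCivitaAt (fun y => bil (G y)) (conn G) y where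
  symm_metric := bil_symm (hG.symm hy)
  symm_deriv w u v := by
    rw [fderiv_bil (hG.differentiableAt hy)]
    refine bil_symm (fun i j => ?_) u v
    have : (fun z => G z i j) =ᶠ[𝓝 y] fun z => G z j i := by
      filter_upwards [hG.isOpen.mem_nhds hy] with z hz using hG.symm hz i j
    simp only [Matrix.of_apply]
    rw [this.fderiv_eq]
  symm u v := by
    ext c
    rw [conn_apply, conn_apply, Finset.sum_comm]
    exact Finset.sum_congr rfl fun i _ => Finset.sum_congr rfl fun j _ => by
      rw [hG.christoffel_symm hy j i]; ring
  koszul u v w := by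
    let D := fderiv ℝ (fun y => bil (G y)) y
    let S : MultilinearMap ℝ (fun _ : Fin 3 => Coord n) ℝ :=
      multilinear₃ (fun u v w => bil (G y) (conn G y u v) w) (fun _ _ => ⟨by simp, by simp⟩)
        (fun _ _ => ⟨by simp, by simp⟩) (fun _ _ => ⟨by simp, by simp⟩)
    let T : MultilinearMap ℝ (fun _ : Fin 3 => Coord n) ℝ :=
      multilinear₃ (fun u v w => (1 / 2) * (D u v w + D v u w - D w u v))
        (fun _ _ => ⟨by intros; simp; ring, by intros; simp; ring⟩)
        (fun _ _ => ⟨by intros; simp; ring, by intros; simp; ring⟩)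
        (fun _ _ => ⟨by intros; simp; ring, by intros; simp; ring⟩)
    -- Both sides of the Koszul formula are trilinear, so basis vectors suffice.
    have hST : S = T := by
      refine multilinear_ext_components fun I => ?_
      change bil (G y) (conn G y _ _) _ = (1 / 2) * (D _ _ _ + D _ _ _ - D _ _ _)
      simp only [D, fderiv_bil_single (hG.differentiableAt hy)]
      rw [← hG.sum_mul_christoffel hy, conn_single_eq_sum]
      simp [bil_single]
    exact congrArg (fun F : MultilinearMap ℝ (fun _ : Fin 3 => Coord n) ℝ => F ![u, v, w]) hST

theorem IsMetricOn.isMetricNear (hG : IsMetricOn G U) (hy : y ∈ U) :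
    IsMetricNear (fun y => bil (G y)) (conn G) y where
  leviCivita := by
    filter_upwards [hG.isOpen.mem_nhds hy] with z hz using hG.isLeviCivitaAt hz
  contDiffAt := ((contDiffOn_bil hG.contDiffOn).contDiffAt (hG.isOpen.mem_nhds hy)).of_le
    ENat.LEInfty.out
  differentiableAt_conn := ((hG.contDiffOn_conn).contDiffAt
    (hG.isOpen.mem_nhds hy)).differentiableAt (by simp)

theorem covDeriv_eq_components (hB : ∀ i j, DifferentiableAt ℝ (fun y => B y i j) y)
    (I : Fin 3 → Fin n) :
    covDeriv G (fun (I : Fin 2 → Fin n) y => B y (I 0) (I 1)) I y =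
      components (cov1Multilinear (conn G) (fun y => bil (B y)) y) I := by
  change _ = cov1 _ _ _ _ _ _
  unfold cov1 covDeriv
  rw [fderiv_bil_single hB, conn_single_eq_sum, conn_single_eq_sum]
  simp only [Fin.sum_univ_two, map_sum, map_smul, sum_apply, smul_apply, bil_single, smul_eq_mul]
  simp [Fin.tail, Function.update]
  ring

theorem _root_.IsLinearMap.map_sum_smul {W : Type*} [AddCommGroup W] [Module ℝ W] {F : W → ℝ}
    (h : IsLinearMap ℝ F) {ι : Type*} (s : Finset ι) (r : ι → ℝ) (x : ι → W) :
    F (∑ i ∈ s, r i • x i) = ∑ i ∈ s, r i * F (x i) :=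
  (map_sum (h.mk' F) _ _).trans (Finset.sum_congr rfl fun _ _ => h.map_smul _ _)

/-- The outer derivative acts on the first covariant derivative, so the identification of the latter
with `cov1` is needed on a whole neighborhood of y. This is where the open set U enters. -/
theorem covDeriv_covDeriv_eq_components (hU : IsOpen U) (hy : y ∈ U)
    (hB : ∀ i j, ContDiffOn ℝ ∞ (fun y => B y i j) U)
    (h1 : ContDiffAt ℝ 2 (fun y => bil (B y)) y) (h2 : DifferentiableAt ℝ (conn G) y)
    (I : Fin 4 → Fin n) :
    covDeriv G (covDeriv G (fun (I : Fin 2 → Fin n) y => B y (I 0) (I 1))) I y =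
      components (cov2Multilinear (conn G) (fun y => bil (B y)) y h1 h2) I := by
  have hd : ∀ z ∈ U, ∀ i j, DifferentiableAt ℝ (fun y => B y i j) z := fun z hz i j =>
    ((hB i j).contDiffAt (hU.mem_nhds hz)).differentiableAt (by simp)
  change _ = cov2 _ _ _ _ _ _ _
  unfold cov2
  have hc : ∀ S : (Fin 3 → Fin n) → Coord n → ℝ, covDeriv G S I y = pderiv (I 0) (S (Fin.tail I)) y
      - ∑ r : Fin 3, ∑ s : Fin n, christoffel G (I 0) (Fin.tail I r) s y *
        S (Function.update (Fin.tail I) r s) y := fun S => rfl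
  rw [hc]
  have hev : covDeriv G (fun (I : Fin 2 → Fin n) y => B y (I 0) (I 1)) (Fin.tail I) =ᶠ[𝓝 y]
      fun z => cov1 (conn G) (fun y => bil (B y)) z (EuclideanSpace.single (I 1) 1)
        (EuclideanSpace.single (I 2) 1) (EuclideanSpace.single (I 3) 1) := by
    filter_upwards [hU.mem_nhds hy] with z hz
    exact covDeriv_eq_components (hd z hz) _
  rw [pderiv, hev.fderiv_eq]
  simp only [covDeriv_eq_components (hd y hy)]
  have e : ∀ J : Fin 3 → Fin n, components (cov1Multilinear (conn G) (fun y => bil (B y)) y) J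
    = cov1 (conn G) (fun y => bil (B y)) y (EuclideanSpace.single (J 0) 1)
        (EuclideanSpace.single (J 1) 1) (EuclideanSpace.single (J 2) 1) := fun J => rfl
  simp only [e, Fin.sum_univ_three]
  rw [conn_single_eq_sum, conn_single_eq_sum, conn_single_eq_sum]
  rw [(isLinearMap_cov1₀ _ _).map_sum_smul, (isLinearMap_cov1₁ _ _).map_sum_smul,
    (isLinearMap_cov1₂ _ _).map_sum_smul]
  simp [Fin.tail, Function.update]
  ring

theorem ricciCoeff_eq_components (hG : IsMetricOn G U) (hy : y ∈ U) (I : Fin 2 → Fin n) :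
    ricciCoeff G (I 0) (I 1) y = components (ricciMultilinear (conn G) y) I := by
  change _ = ∑ c : Fin n, (curvVec _ _ _ _ _ : Coord n) c
  unfold ricciCoeff curvVec
  refine Finset.sum_congr rfl fun c _ => ?_
  have hd : DifferentiableAt ℝ (conn G) y := (hG.isMetricNear hy).differentiableAt_conn
  have h1 : ∀ a b c d, fderiv ℝ (conn G) y (EuclideanSpace.single a 1) (EuclideanSpace.single b 1)
      (EuclideanSpace.single c 1) d = pderiv a (christoffel G b c d) y := by
    intro a b c d
    have h2 : christoffel G b c d = fun z => (EuclideanSpace.proj d : Coord n →L[ℝ] ℝ)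
        (conn G z (EuclideanSpace.single b 1) (EuclideanSpace.single c 1)) := by
      funext z
      exact (conn_single b c d).symm
    have h4 : DifferentiableAt ℝ (fun z => conn G z (EuclideanSpace.single b 1)
      (EuclideanSpace.single c 1)) y := by fun_prop
    have h5 := ((EuclideanSpace.proj d : Coord n →L[ℝ] ℝ).hasFDerivAt.comp y h4.hasFDerivAt).fderiv
    rw [h2, pderiv]
    change _ = fderiv ℝ (_ ∘ _) _ _
    rw [h5, ContinuousLinearMap.comp_apply, fderiv_apply₂ hd (by fun_prop) (by fun_prop)]
    simp
  have h3 : ∀ a b c d : Fin n, conn G y (EuclideanSpace.single d 1)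
      (conn G y (EuclideanSpace.single a 1) (EuclideanSpace.single b 1)) c
      = ∑ e, christoffel G a b e y * christoffel G d e c y := by
    intro a b c d
    conv_lhs => rw [conn_single_eq_sum a b]
    simp [conn_single]
  simp [h1, h3]

end Coordinates

end YamabeMap

namespace YamabeMap

/-! ### Pointwise comparison of two metrics that are close to second order. -/

section Pointwise

variable {n : ℕ} {G H K B : Coord n → Matrix (Fin n) (Fin n) ℝ} {U : Set (Coord n)} {y : Coord n}
  {δ : ℝ}

/-- The tensor `B` and its first two covariant derivatives are bounded by `δ` at a point. -/
def JetBound (G B : Coord n → Matrix (Fin n) (Fin n) ℝ) (y : Coord n) (δ : ℝ) : Prop :=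
  ∀ i ≤ 2, tensorNorm (G y) (fun J => iterCovDeriv G
    (fun (I : Fin 2 → Fin n) y => B y (I 0) (I 1)) i J y) ≤ δ

/-- The multilinear form of `JetBound`. -/
structure JetBoundML (G B : Coord n → Matrix (Fin n) (Fin n) ℝ) (N : Coord n → ℝ)
    (y : Coord n) (δ : ℝ) : Prop where
  zero : ∀ u v, |bil (B y) u v| ≤ δ * (N u * N v)
  one : ∀ w u v, |cov1 (conn G) (fun y => bil (B y)) y w u v| ≤ δ * (N w * N u * N v)
  two : ∀ e w u v, |cov2 (conn G) (fun y => bil (B y)) y e w u v| ≤ δ * (N e * N w * N u * N v)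

theorem contDiffAt_bil (hU : IsOpen U) (hy : y ∈ U)
    (hB : ∀ i j, ContDiffOn ℝ ∞ (fun y => B y i j) U) : ContDiffAt ℝ 2 (fun y => bil (B y)) y :=
  ((contDiffOn_bil hB).contDiffAt (hU.mem_nhds hy)).of_le ENat.LEInfty.out

theorem iterCovDeriv_zero_eq (I : Fin 2 → Fin n) :
    iterCovDeriv G (fun (I : Fin 2 → Fin n) y => B y (I 0) (I 1)) 0 I y
      = components (bilMultilinear (bil (B y))) I := by
  change _ = bil (B y) _ _
  rw [bil_single]
  rfl

theorem JetBound.multilinear (hG : IsMetricOn G U) (hy : y ∈ U)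
    (hB : ∀ i j, ContDiffOn ℝ ∞ (fun y => B y i j) U) (h : JetBound G B y δ) :
    JetBoundML G B (gnorm (bil (G y))) y δ := by
  obtain ⟨f, l, hf⟩ := exists_isFrame (hG.posDef y hy) (hG.posDef y hy).isHermitian
  have hd : ∀ i j, DifferentiableAt ℝ (fun y => B y i j) y := fun i j =>
    ((hB i j).contDiffAt (hG.isOpen.mem_nhds hy)).differentiableAt (by simp)
  have h2 := contDiffAt_bil hG.isOpen hy hB
  have hc := (hG.isMetricNear hy).differentiableAt_conn
  have hN := gnorm_nonneg (bil (G y))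
  refine ⟨fun u v => ?_, fun w u v => ?_, fun e w u v => ?_⟩
  · have h0 := h 0 (by norm_num)
    simp only [iterCovDeriv_zero_eq] at h0
    have := hf.abs_multilinear_le (bilMultilinear (bil (B y))) ![u, v]
    rw [bilMultilinear_apply] at this
    refine this.trans ?_
    rw [Fin.prod_univ_two]
    exact mul_le_mul_of_nonneg_right h0 (mul_nonneg (hN _) (hN _))
  · have h1 : tensorNorm (G y) (fun J => covDeriv G
      (fun (I : Fin 2 → Fin n) y => B y (I 0) (I 1)) J y) ≤ δ := h 1 (by norm_num)
    simp only [covDeriv_eq_components hd] at h1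
    have := hf.abs_multilinear_le (cov1Multilinear (conn G) (fun y => bil (B y)) y) ![w, u, v]
    rw [cov1Multilinear_apply] at this
    refine this.trans ?_
    rw [Fin.prod_univ_three]
    exact mul_le_mul_of_nonneg_right h1 (mul_nonneg (mul_nonneg (hN _) (hN _)) (hN _))
  · have h1 : tensorNorm (G y) (fun J => covDeriv G (covDeriv G
      (fun (I : Fin 2 → Fin n) y => B y (I 0) (I 1))) J y) ≤ δ := h 2 le_rfl
    simp only [covDeriv_covDeriv_eq_components hG.isOpen hy hB h2 hc] at h1
    have := hf.abs_multilinear_le (cov2Multilinear (conn G) (fun y => bil (B y)) y h2 hc)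
      ![e, w, u, v]
    rw [cov2Multilinear_apply] at this
    refine this.trans ?_
    rw [Fin.prod_univ_four]
    exact mul_le_mul_of_nonneg_right h1
      (mul_nonneg (mul_nonneg (mul_nonneg (hN _) (hN _)) (hN _)) (hN _))

/-- One constant serves the ranks 2, 3 and 4. The base n + 1 is at least 1, so its powers increase
with the exponent even for n = 0. -/
theorem sqrt_pow_le {m : ℕ} (hm : m ≤ 4) : √((n : ℝ) ^ m) ≤ (n + 1) ^ 2 := by
  rw [Real.sqrt_le_left (by positivity)]
  calc (n : ℝ) ^ m ≤ (n + 1) ^ m := by gcongr; linarith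
    _ ≤ (n + 1) ^ 4 := by gcongr; linarith [(Nat.cast_nonneg n : (0 : ℝ) ≤ n)]
    _ = _ := by ring

/-- The converse of `JetBound.multilinear`. It loses a dimensional constant because the tensor norm
sums the squares of up to n⁴ components. -/
theorem JetBoundML.jetBound (hG : IsMetricOn G U) (hy : y ∈ U)
    (hB : ∀ i j, ContDiffOn ℝ ∞ (fun y => B y i j) U) (hδ : 0 ≤ δ)
    (h : JetBoundML G B (gnorm (bil (G y))) y δ) : JetBound G B y ((n + 1) ^ 2 * δ) := by
  obtain ⟨f, l, hf⟩ := exists_isFrame (hG.posDef y hy) (hG.posDef y hy).isHermitian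
  have hd : ∀ i j, DifferentiableAt ℝ (fun y => B y i j) y := fun i j =>
    ((hB i j).contDiffAt (hG.isOpen.mem_nhds hy)).differentiableAt (by simp)
  have h2 := contDiffAt_bil hG.isOpen hy hB
  have hc := (hG.isMetricNear hy).differentiableAt_conn
  intro i hi
  interval_cases i
  · simp only [iterCovDeriv_zero_eq]
    refine (hf.tensorNorm_le _ hδ fun u => ?_).trans
      (mul_le_mul_of_nonneg_right (sqrt_pow_le (by norm_num)) hδ)
    rw [Fin.prod_univ_two]
    exact h.zero _ _
  · change tensorNorm (G y) (fun J => covDeriv G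
      (fun (I : Fin 2 → Fin n) y => B y (I 0) (I 1)) J y) ≤ _
    simp only [covDeriv_eq_components hd]
    refine (hf.tensorNorm_le _ hδ fun u => ?_).trans
      (mul_le_mul_of_nonneg_right (sqrt_pow_le (by norm_num)) hδ)
    rw [Fin.prod_univ_three]
    exact h.one _ _ _
  · change tensorNorm (G y) (fun J => covDeriv G (covDeriv G
      (fun (I : Fin 2 → Fin n) y => B y (I 0) (I 1))) J y) ≤ _
    simp only [covDeriv_covDeriv_eq_components hG.isOpen hy hB h2 hc]
    refine (hf.tensorNorm_le _ hδ fun u => ?_).trans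
      (mul_le_mul_of_nonneg_right (sqrt_pow_le (by norm_num)) hδ)
    rw [Fin.prod_univ_four]
    exact h.two _ _ _ _

theorem bil_sub_fun : (fun y => bil ((H - G) y)) = (fun y => bil (H y)) - fun y => bil (G y) := by
  funext y
  simp

theorem IsMetricOn.sub_contDiffOn (hG : IsMetricOn G U) (hH : IsMetricOn H U) (i j : Fin n) :
    ContDiffOn ℝ ∞ (fun y => (H - G) y i j) U :=
  (hH.contDiffOn i j).sub (hG.contDiffOn i j)

theorem IsFrame.right_self {A C : Matrix (Fin n) (Fin n) ℝ} {f l} (h : IsFrame A C f l)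
    (x : Coord n) : bil C x x = ∑ i, l i * bil A x (f i) ^ 2 := by
  conv_lhs => rw [h.expand x]
  simp only [map_sum, map_smul, sum_apply, smul_apply, h.right]
  simp [pow_two]
  exact Finset.sum_congr rfl fun i _ => by ring

/-- Evaluating C - A twice on the unit vector fᵢ yields lᵢ - 1: the relative eigenvalues are within
δ of 1. -/
theorem IsFrame.abs_sub_one_le {A C : Matrix (Fin n) (Fin n) ℝ} {f l} (h : IsFrame A C f l)
    (h0 : ∀ u v, |bil (C - A) u v| ≤ δ * (gnorm (bil A) u * gnorm (bil A) v)) (i : Fin n) :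
    |l i - 1| ≤ δ := by
  have := h0 (f i) (f i)
  simpa [h.gnorm_self, h.left, h.right] using this

theorem IsFrame.le_two_mul {A C : Matrix (Fin n) (Fin n) ℝ} {f l} (h : IsFrame A C f l)
    (hl : ∀ i, |l i - 1| ≤ 1 / 2) (u : Coord n) : bil A u u ≤ 2 * bil C u u := by
  rw [h.right_self, h.sum_sq, Finset.mul_sum]
  refine Finset.sum_le_sum fun i _ => ?_
  have := (abs_le.1 (hl i)).1
  nlinarith [sq_nonneg (bil A u (f i))]

theorem IsFrame.right_le_four_mul {A C : Matrix (Fin n) (Fin n) ℝ} {f l} (h : IsFrame A C f l)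
    (hl : ∀ i, |l i - 1| ≤ 1 / 2) (u : Coord n) : bil C u u ≤ 4 * bil A u u := by
  rw [h.right_self, h.sum_sq, Finset.mul_sum]
  refine Finset.sum_le_sum fun i _ => ?_
  have := (abs_le.1 (hl i)).2
  nlinarith [sq_nonneg (bil A u (f i))]

theorem abs_inv_sub_one_le {l : ℝ} (hl : |l - 1| ≤ δ) (hδ : δ ≤ 1 / 2) : |l⁻¹ - 1| ≤ 2 * δ := by
  have h1 := abs_le.1 hl
  have hpos : 1 / 2 ≤ l := by linarith
  have : l⁻¹ - 1 = (1 - l) * l⁻¹ := by field_simp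
  rw [this, abs_mul, abs_sub_comm, abs_of_pos (inv_pos.2 (by linarith : 0 < l)), mul_comm (2 : ℝ)]
  refine mul_le_mul hl ?_ (by positivity) ((abs_nonneg _).trans hl)
  rw [inv_le_comm₀ (by linarith) (by norm_num)]
  linarith

theorem sum_sum_mul_components (w : Fin n → ℝ) (f : Fin n → Coord n)
    (R : MultilinearMap ℝ (fun _ : Fin 2 => Coord n) ℝ) :
    ∑ a, ∑ b, (∑ i, w i * (f i a * f i b)) * components R ![a, b] = ∑ i, w i * R ![f i, f i] := by
  have h1 : ∀ i, R ![f i, f i] = ∑ a, ∑ b, (f i a * f i b) * components R ![a, b] := by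
    intro i
    rw [multilinear_apply_eq_sum, ← (finTwoArrowEquiv (Fin n)).symm.sum_comp, Fintype.sum_prod_type]
    simp [Fin.prod_univ_two, finTwoArrowEquiv]
  simp only [h1, Finset.sum_mul, Finset.mul_sum]
  calc _ = ∑ a, ∑ i, ∑ b, w i * (f i a * f i b) * components R ![a, b] :=
        Finset.sum_congr rfl fun a _ => Finset.sum_comm
    _ = ∑ i, ∑ a, ∑ b, w i * (f i a * f i b) * components R ![a, b] := Finset.sum_comm
    _ = _ := by simp only [mul_assoc]

theorem IsMetricOn.scalCoeff_eq_sum (hG : IsMetricOn G U) (hy : y ∈ U) {w : Fin n → ℝ}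
    {f : Fin n → Coord n} (h : ∀ a b, (G y)⁻¹ a b = ∑ i, w i * (f i a * f i b)) :
    scalCoeff G y = ∑ i, w i * ricciMultilinear (conn G) y ![f i, f i] := by
  rw [← sum_sum_mul_components]
  unfold scalCoeff
  refine Finset.sum_congr rfl fun a _ => Finset.sum_congr rfl fun b _ => ?_
  rw [h, ← ricciCoeff_eq_components hG hy]
  rfl

/-- By `curvVec_sub` each summand of the trace over the frame has two ∇D terms of size 9δ and two
D∗D terms of size (3δ)² ≤ 9δ, hence 36δ. The factor n is the number of summands. -/
theorem IsFrame.abs_ricci_sub_le {C : Matrix (Fin n) (Fin n) ℝ} {f l} (hf : IsFrame (G y) C f l)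
    (hG : IsMetricOn G U) (hH : IsMetricOn H U) (hy : y ∈ U)
    (hle : ∀ u, bil (G y) u u ≤ 2 * bil (H y) u u) (hδ0 : 0 ≤ δ) (hδ1 : δ ≤ 1)
    (h : JetBoundML G (H - G) (gnorm (bil (G y))) y δ) (i : Fin n) :
    |ricciMultilinear (conn H) y ![f i, f i] - ricciMultilinear (conn G) y ![f i, f i]|
      ≤ n * (36 * δ) := by
  have mG := hG.isMetricNear hy
  have mH := hH.isMetricNear hy
  have h1 := h.one
  have h2 := h.two
  rw [bil_sub_fun] at h1 h2
  have hD := gnorm_connDiff_le mG mH hle hδ0 h1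
  have hC := gnorm_covConn_le mG mH hle hδ0 h1 hδ1 h2
  have hDD : ∀ a b c, gnorm (bil (G y)) (f a) = 1 → gnorm (bil (G y)) (f b) = 1 →
      gnorm (bil (G y)) (f c) = 1 → gnorm (bil (G y)) ((conn H - conn G) y (f a)
        ((conn H - conn G) y (f b) (f c))) ≤ 9 * δ := by
    intro a b c ha hb hc
    have e1 := hD (f b) (f c)
    have e2 := hD (f a) ((conn H - conn G) y (f b) (f c))
    rw [ha, one_mul] at e2
    rw [hb, hc] at e1
    nlinarith
  rw [hf.ricci_eq, hf.ricci_eq, ← Finset.sum_sub_distrib]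
  refine (Finset.abs_sum_le_sum_abs _ _).trans ?_
  calc _ ≤ ∑ _j : Fin n, 36 * δ := Finset.sum_le_sum fun j _ => ?_
    _ = _ := by simp
  simp only [Matrix.cons_val_zero, Matrix.cons_val_one]
  rw [← sub_apply, ← map_sub, curvVec_sub mG.leviCivita.self_of_nhds.symm
    mH.leviCivita.self_of_nhds.symm mG.differentiableAt_conn mH.differentiableAt_conn]
  simp only [map_add, map_sub, add_apply, sub_apply]
  have n1 := hf.gnorm_self i
  have n2 := hf.gnorm_self j
  have c1 := hC (f j) (f i) (f i)
  have c2 := hC (f i) (f i) (f j)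
  simp only [n1, n2] at c1 c2
  have b1 := (hf.abs_bil_le (covConn (conn G) (conn H - conn G) y (f j) (f i) (f i)) j).trans c1
  have b2 := (hf.abs_bil_le (covConn (conn G) (conn H - conn G) y (f i) (f i) (f j)) j).trans c2
  have b3 := (hf.abs_bil_le ((conn H - conn G) y (f j) ((conn H - conn G) y (f i) (f i))) j).trans
    (hDD _ _ _ n2 n1 n1)
  have b4 := (hf.abs_bil_le ((conn H - conn G) y (f i) ((conn H - conn G) y (f i) (f j))) j).trans
    (hDD _ _ _ n1 n1 n2)
  rw [abs_le] at *
  constructor <;> linarith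

/-- Scalar curvature depends continuously on the metric, in a quantitative way. -/
theorem abs_scalCoeff_sub_le (hG : IsMetricOn G U) (hH : IsMetricOn H U) (hy : y ∈ U)
    (hδ0 : 0 ≤ δ) (hδ : δ ≤ 1 / 2) (h : JetBound G (H - G) y δ) :
    |scalCoeff H y - scalCoeff G y| ≤ 72 * (n + 1) ^ 2 * δ *
      (1 + tensorNorm (G y) (fun I : Fin 2 → Fin n => ricciCoeff G (I 0) (I 1) y)) := by
  have hM := h.multilinear hG hy (hG.sub_contDiffOn hH)
  obtain ⟨f, l, hf⟩ := exists_isFrame (hG.posDef y hy) (hH.posDef y hy).isHermitian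
  have hl := hf.abs_sub_one_le (δ := δ) hM.zero
  have hl' : ∀ i, |l i - 1| ≤ 1 / 2 := fun i => (hl i).trans hδ
  have hl0 : ∀ i, l i ≠ 0 := fun i => by
    have := (abs_le.1 (hl' i)).1
    intro h0
    rw [h0] at this
    norm_num at this
  rw [hG.scalCoeff_eq_sum hy (w := fun _ => 1) (f := f) (by simpa using hf.inv_left),
    hH.scalCoeff_eq_sum hy (hf.inv_right hl0), ← Finset.sum_sub_distrib]
  simp only [ricciCoeff_eq_components hG hy]
  set ρ := tensorNorm (G y) (fun I => components (ricciMultilinear (conn G) y) I) with hρ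
  have hρ0 : 0 ≤ ρ := Real.sqrt_nonneg _
  refine (Finset.abs_sum_le_sum_abs _ _).trans ?_
  calc _ ≤ ∑ _i : Fin n, (2 * δ * ρ + 2 * (n * (36 * δ))) := Finset.sum_le_sum fun i _ => ?_
    _ = n * (2 * δ * ρ + 2 * (n * (36 * δ))) := by simp; ring
    _ ≤ _ := by
      have hn : (0 : ℝ) ≤ n := Nat.cast_nonneg n
      have e1 : 0 ≤ n * δ * ρ := by positivity
      have e2 : 0 ≤ n * δ := by positivity
      have e3 : 0 ≤ n * n * δ * ρ := by positivity
      have e4 : 0 ≤ δ * ρ := by positivity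
      nlinarith
  have r1 := hf.abs_ricci_sub_le hG hH hy (hf.le_two_mul hl') hδ0 (by linarith) hM i
  have r2 : |ricciMultilinear (conn G) y ![f i, f i]| ≤ ρ := by
    have := hf.abs_multilinear_le (ricciMultilinear (conn G) y) ![f i, f i]
    simpa [Fin.prod_univ_two, hf.gnorm_self] using this
  have r3 := abs_inv_sub_one_le (hl i) hδ
  have r4 : |(l i)⁻¹| ≤ 2 := by
    have := abs_le.1 r3
    rw [abs_le]
    constructor <;> linarith
  -- The error has two sources. The weights lᵢ⁻¹ differ from 1, which costs 2δ times a component of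
  -- Ric_G and not of its trace. The Ricci tensor itself also changes, and there lᵢ⁻¹ ≤ 2 is used.
  have e : (l i)⁻¹ * ricciMultilinear (conn H) y ![f i, f i]
      - 1 * ricciMultilinear (conn G) y ![f i, f i]
      = ((l i)⁻¹ - 1) * ricciMultilinear (conn G) y ![f i, f i]
        + (l i)⁻¹ * (ricciMultilinear (conn H) y ![f i, f i]
          - ricciMultilinear (conn G) y ![f i, f i]) := by ring
  rw [e]
  refine (abs_add_le _ _).trans ?_
  rw [abs_mul, abs_mul]
  gcongr

/-- The norms of a covector with respect to two close metrics are close. -/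
theorem abs_tensorNorm_sq_sub_le (hG : IsMetricOn G U) (hH : IsMetricOn H U) (hy : y ∈ U)
    (hδ : δ ≤ 1 / 2) (h : JetBound G (H - G) y δ) (p : Fin n → ℝ) :
    |tensorNorm (H y) (fun I : Fin 1 → Fin n => p (I 0)) ^ 2
      - tensorNorm (G y) (fun I : Fin 1 → Fin n => p (I 0)) ^ 2|
      ≤ 2 * δ * tensorNorm (G y) (fun I : Fin 1 → Fin n => p (I 0)) ^ 2 := by
  have hM := h.multilinear hG hy (hG.sub_contDiffOn hH)
  obtain ⟨f, l, hf⟩ := exists_isFrame (hG.posDef y hy) (hH.posDef y hy).isHermitian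
  have hl := hf.abs_sub_one_le (δ := δ) hM.zero
  have hl0 : ∀ i, 1 / 2 ≤ l i := fun i => by linarith [(abs_le.1 ((hl i).trans hδ)).1]
  -- Both inverse matrices are diagonal in the common frame, with weights 1 and lᵢ⁻¹, so the squared
  -- covector norms are compared term by term.
  have key : ∀ (A : Matrix (Fin n) (Fin n) ℝ) (w : Fin n → ℝ), (∀ i, 0 ≤ w i) →
      (∀ a b, A⁻¹ a b = ∑ i, w i * (f i a * f i b)) →
      tensorNorm A (fun I : Fin 1 → Fin n => p (I 0)) ^ 2
        = ∑ i, w i * (∑ a, f i a * p a) ^ 2 := by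
    intro A w hw hA
    have : ∑ I : Fin 1 → Fin n, ∑ J : Fin 1 → Fin n, (∏ r, A⁻¹ (I r) (J r)) * p (I 0) * p (J 0)
        = ∑ i, w i * (∑ a, f i a * p a) ^ 2 := by
      simp only [← (Equiv.funUnique (Fin 1) (Fin n)).symm.sum_comp]
      simp only [Finset.univ_unique, Fin.default_eq_zero, Finset.prod_singleton,
        Equiv.funUnique_symm_apply, uniqueElim_const, hA, pow_two, Finset.sum_mul, Finset.mul_sum]
      calc _ = ∑ a, ∑ i, ∑ b, w i * (f i a * f i b) * p a * p b :=
            Finset.sum_congr rfl fun a _ => Finset.sum_comm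
        _ = ∑ i, ∑ a, ∑ b, w i * (f i a * f i b) * p a * p b := Finset.sum_comm
        _ = _ := by
          refine Finset.sum_congr rfl fun i _ => ?_
          rw [Finset.sum_comm]
          exact Finset.sum_congr rfl fun a _ => Finset.sum_congr rfl fun b _ => by ring
    rw [tensorNorm, this, Real.sq_sqrt (Finset.sum_nonneg fun i _ => mul_nonneg (hw i) (sq_nonneg _))]
  rw [key (G y) (fun _ => 1) (by simp) (by simpa using hf.inv_left),
    key (H y) _ (fun i => inv_nonneg.2 (by linarith [hl0 i]))
      (hf.inv_right fun i => by linarith [hl0 i] |> fun h : 0 < l i => h.ne'),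
    ← Finset.sum_sub_distrib, Finset.mul_sum]
  refine (Finset.abs_sum_le_sum_abs _ _).trans (Finset.sum_le_sum fun i _ => ?_)
  rw [← sub_mul, abs_mul, one_mul, abs_of_nonneg (sq_nonneg (∑ a, f i a * p a))]
  exact mul_le_mul_of_nonneg_right (abs_inv_sub_one_le (hl i) hδ) (sq_nonneg _)

theorem det_bounds (hG : IsMetricOn G U) (hH : IsMetricOn H U) (hy : y ∈ U)
    (hδ : δ ≤ 1 / 2) (h : JetBound G (H - G) y δ) :
    (1 - δ) ^ n * (G y).det ≤ (H y).det ∧ (H y).det ≤ (1 + δ) ^ n * (G y).det := by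
  have hM := h.multilinear hG hy (hG.sub_contDiffOn hH)
  obtain ⟨f, l, hf⟩ := exists_isFrame (hG.posDef y hy) (hH.posDef y hy).isHermitian
  have hl := hf.abs_sub_one_le (δ := δ) hM.zero
  have hdet := (hG.posDef y hy).det_pos.le
  rw [hf.det_right]
  constructor
  · refine mul_le_mul_of_nonneg_right ?_ hdet
    calc (1 - δ) ^ n = ∏ _i : Fin n, (1 - δ) := by simp
      _ ≤ _ := Finset.prod_le_prod (fun _ _ => by linarith)
        fun i _ => by linarith [(abs_le.1 (hl i)).1]
  · refine mul_le_mul_of_nonneg_right ?_ hdet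
    calc _ ≤ ∏ _i : Fin n, (1 + δ) := Finset.prod_le_prod
          (fun i _ => by linarith [(abs_le.1 (hl i)).1]) fun i _ => by linarith [(abs_le.1 (hl i)).2]
      _ = _ := by simp

/-- A weak triangle inequality for the norms of jets with respect to varying metrics. -/
theorem JetBound.trans (hG : IsMetricOn G U) (hH : IsMetricOn H U) (hK : IsMetricOn K U)
    (hy : y ∈ U) (hδ0 : 0 ≤ δ) (hδ : δ ≤ 1 / 2) (h : JetBound G (H - G) y δ)
    (h' : JetBound H (K - H) y δ) : JetBound G (K - G) y ((n + 1) ^ 2 * (1121 * δ)) := by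
  have hM := h.multilinear hG hy (hG.sub_contDiffOn hH)
  have hM' := h'.multilinear hH hy (hH.sub_contDiffOn hK)
  obtain ⟨f, l, hf⟩ := exists_isFrame (hG.posDef y hy) (hH.posDef y hy).isHermitian
  have hl' : ∀ i, |l i - 1| ≤ 1 / 2 := fun i => (hf.abs_sub_one_le (δ := δ) hM.zero i).trans hδ
  have hle := hf.le_two_mul hl'
  have hN : ∀ u, gnorm (bil (H y)) u ≤ 2 * gnorm (bil (G y)) u := fun u =>
    gnorm_le_two_mul (hf.right_le_four_mul hl' u)
  have mG := hG.isMetricNear hy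
  have mH := hH.isMetricNear hy
  have hT := contDiffAt_bil hG.isOpen hy (hH.sub_contDiffOn hK)
  have hE := contDiffAt_bil hG.isOpen hy (hG.sub_contDiffOn hH)
  have n0 := gnorm_nonneg (bil (H y))
  have n0' := gnorm_nonneg (bil (G y))
  -- H-lengths are at most twice G-lengths, so up to four arguments cost at most 2⁴ = 16.
  have t0 : ∀ u v, |bil ((K - H) y) u v| ≤ 16 * δ * (gnorm (bil (G y)) u * gnorm (bil (G y)) v) := by
    intro u v
    refine (hM'.zero u v).trans ?_
    have := mul_nonneg hδ0 (mul_nonneg (n0' u) (n0' v))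
    calc _ ≤ δ * ((2 * gnorm (bil (G y)) u) * (2 * gnorm (bil (G y)) v)) := by
          gcongr <;> first | exact n0 _ | exact hN _ | exact mul_nonneg zero_le_two (n0' _)
      _ ≤ _ := by linarith
  have t1 : ∀ w u v, |cov1 (conn H) (fun y => bil ((K - H) y)) y w u v| ≤
      16 * δ * (gnorm (bil (G y)) w * gnorm (bil (G y)) u * gnorm (bil (G y)) v) := by
    intro w u v
    refine (hM'.one w u v).trans ?_
    have := mul_nonneg hδ0 (mul_nonneg (mul_nonneg (n0' w) (n0' u)) (n0' v))
    have a1 := n0 w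
    have a2 := n0 u
    have a3 := n0 v
    have b1 := n0' w
    have b2 := n0' u
    calc _ ≤ δ * ((2 * gnorm (bil (G y)) w) * (2 * gnorm (bil (G y)) u)
          * (2 * gnorm (bil (G y)) v)) := by
          gcongr <;> exact hN _
      _ ≤ _ := by linarith
  have t2 : ∀ e w u v, |cov2 (conn H) (fun y => bil ((K - H) y)) y e w u v| ≤
      16 * δ * (gnorm (bil (G y)) e * gnorm (bil (G y)) w * gnorm (bil (G y)) u
        * gnorm (bil (G y)) v) := by
    intro e w u v
    refine (hM'.two e w u v).trans ?_
    have a0 := n0 e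
    have a1 := n0 w
    have a2 := n0 u
    have a3 := n0 v
    have b0 := n0' e
    have b1 := n0' w
    have b2 := n0' u
    calc _ ≤ δ * ((2 * gnorm (bil (G y)) e) * (2 * gnorm (bil (G y)) w)
          * (2 * gnorm (bil (G y)) u) * (2 * gnorm (bil (G y)) v)) := by
          gcongr <;> exact hN _
      _ = _ := by ring
  have h1 := hM.one
  have h2 := hM.two
  rw [bil_sub_fun] at h1 h2
  have c1 := abs_cov1_le mG mH hle hδ0 h1 (by linarith) (by positivity) t0 t1
  have c2 := abs_cov2_le mG mH hle hδ0 h1 (by linarith) h2 hT (by positivity) t0 t1 t2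
  have hsum : (fun y => bil ((K - G) y)) = (fun y => bil ((K - H) y)) + fun y => bil ((H - G) y) := by
    funext y
    simp
  -- Split K - G = (K - H) + (H - G). The worst order is the second, with constant 70·16 + 1 = 1121.
  refine JetBoundML.jetBound hG hy (hG.sub_contDiffOn hK) (by positivity) ⟨?_, ?_, ?_⟩
  · intro u v
    have e : bil ((K - G) y) u v = bil ((K - H) y) u v + bil ((H - G) y) u v := by simp
    rw [e]
    have := mul_nonneg hδ0 (mul_nonneg (n0' u) (n0' v))
    exact (abs_add_le _ _).trans (by linarith [t0 u v, hM.zero u v])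
  · intro w u v
    rw [hsum, cov1_add (hT.differentiableAt (by norm_num)) (hE.differentiableAt (by norm_num))]
    have := mul_nonneg hδ0 (mul_nonneg (mul_nonneg (n0' w) (n0' u)) (n0' v))
    exact (abs_add_le _ _).trans (by linarith [c1 w u v, hM.one w u v])
  · intro e w u v
    rw [hsum, cov2_add hT hE mG.differentiableAt_conn]
    exact (abs_add_le _ _).trans (by linarith [c2 e w u v, hM.two e w u v])

end Pointwise

end YamabeMap

namespace YamabeMap

/-! ### Passage from coordinates to the manifold, and neighborhoods in the uniform topology. -/

section Charts

variable {n : ℕ} {M : Type*} [TopologicalSpace M] [ChartedSpace (Coord n) M]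
  [SecondCountableTopology M] [Nonempty M]

theorem coverChart_mem_atlas (k : ℕ) : coverChart n M k ∈ atlas (Coord n) M :=
  chart_mem_atlas _ _

theorem goodChart_mem_atlas (x : M) : goodChart n x ∈ atlas (Coord n) M :=
  chart_mem_atlas _ _

theorem goodChart_mem_target (x : M) : goodChart n x x ∈ (goodChart n x).target :=
  (goodChart n x).map_source (mem_goodChart_source n x)

end Charts

section MetricCoeff

variable {n : ℕ} {M : Type*} [TopologicalSpace M] [ChartedSpace (Coord n) M]
  [IsManifold (𝓡 n) ∞ M]

/-- The field is the tangent map of the smooth map e.symm applied to the constant section y ↦ (y,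
v). -/
theorem contMDiffOn_mfderiv_symm_const {e : OpenPartialHomeomorph M (Coord n)}
    (he : e ∈ atlas (Coord n) M) (v : Coord n) :
    ContMDiffOn 𝓘(ℝ, Coord n) (𝓡 n).tangent ∞
      (fun y => (Bundle.TotalSpace.mk' (Coord n) (e.symm y)
        (mfderiv 𝓘(ℝ, Coord n) (𝓡 n) e.symm y v) : TangentBundle (𝓡 n) M)) e.target := by
  have h1 : ContMDiffOn 𝓘(ℝ, Coord n) (𝓡 n) ∞ e.symm e.target :=
    contMDiffOn_symm_of_mem_maximalAtlas (IsManifold.subset_maximalAtlas he)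
  have h2 := h1.contMDiffOn_tangentMapWithin (m := ∞) (by simp) e.open_target.uniqueMDiffOn
  have h3 : ContMDiff 𝓘(ℝ, Coord n) 𝓘(ℝ, Coord n).tangent ∞
      (fun y : Coord n => (⟨y, v⟩ : TangentBundle 𝓘(ℝ, Coord n) (Coord n))) :=
    contMDiff_vectorSpace_iff_contDiff.2 contDiff_const
  have h4 := h2.comp h3.contMDiffOn (s := e.target) (fun y hy => hy)
  refine h4.congr fun y hy => ?_
  simp only [Function.comp, tangentMapWithin]
  rw [mfderivWithin_of_isOpen e.open_target hy]

theorem contDiffOn_metricCoeff (g : Metr n M) {e : OpenPartialHomeomorph M (Coord n)}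
    (he : e ∈ atlas (Coord n) M) (i j : Fin n) :
    ContDiffOn ℝ ∞ (fun y => metricCoeff g e y i j) e.target := by
  have h1 : ContMDiffOn 𝓘(ℝ, Coord n) (𝓡 n) ∞ e.symm e.target :=
    contMDiffOn_symm_of_mem_maximalAtlas (IsManifold.subset_maximalAtlas he)
  have hg := g.contMDiff.comp_contMDiffOn h1
  have h2 : ContMDiffOn 𝓘(ℝ, Coord n) ((𝓡 n).prod 𝓘(ℝ)) ∞
      (fun y => Bundle.TotalSpace.mk' ℝ (E := Bundle.Trivial M ℝ) (e.symm y)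
        (g.inner (e.symm y)
          (mfderiv 𝓘(ℝ, Coord n) (𝓡 n) e.symm y (EuclideanSpace.single i (1 : ℝ) : Coord n))
          (mfderiv 𝓘(ℝ, Coord n) (𝓡 n) e.symm y (EuclideanSpace.single j (1 : ℝ) : Coord n))))
      e.target :=
    ContMDiffOn.clm_bundle_apply₂ (F₁ := Coord n) (F₂ := Coord n) hg
      (contMDiffOn_mfderiv_symm_const he _) (contMDiffOn_mfderiv_symm_const he _)
  rw [← contMDiffOn_iff_contDiffOn]
  intro y hy
  have h3 := h2 y hy
  simp only [Bundle.contMDiffWithinAt_totalSpace] at h3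
  exact h3.2

theorem bil_metricCoeff (g : Metr n M) (e : OpenPartialHomeomorph M (Coord n)) (y u v : Coord n) :
    bil (metricCoeff g e y) u v = g.inner (e.symm y) (mfderiv 𝓘(ℝ, Coord n) (𝓡 n) e.symm y u)
      (mfderiv 𝓘(ℝ, Coord n) (𝓡 n) e.symm y v) := by
  have h2 : ∀ u : Coord n, u = ∑ c, u c • (EuclideanSpace.single c (1 : ℝ) : Coord n) := by
    intro u
    ext a
    simp [Pi.single_apply]
  let L : Coord n →L[ℝ] TangentSpace (𝓡 n) (e.symm y) := mfderiv 𝓘(ℝ, Coord n) (𝓡 n) e.symm y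
  change _ = g.inner (e.symm y) (L u) (L v)
  rw [bil_apply]
  conv_rhs => rw [h2 u, h2 v]
  simp only [map_sum, map_smul, sum_apply, smul_apply, smul_eq_mul, Finset.mul_sum]
  rw [Finset.sum_comm]
  refine Finset.sum_congr rfl fun i _ => Finset.sum_congr rfl fun j _ => ?_
  have : metricCoeff g e y j i = g.inner (e.symm y) (L (EuclideanSpace.single j (1 : ℝ)))
    (L (EuclideanSpace.single i (1 : ℝ))) := rfl
  rw [this]
  ring

theorem posDef_metricCoeff (g : Metr n M) {e : OpenPartialHomeomorph M (Coord n)}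
    (he : e ∈ atlas (Coord n) M) {y : Coord n} (hy : y ∈ e.target) :
    (metricCoeff g e y).PosDef := by
  refine Matrix.PosDef.of_dotProduct_mulVec_pos ?_ fun x hx => ?_
  · ext i j
    simp only [Matrix.conjTranspose_apply, star_trivial, metricCoeff, Matrix.of_apply]
    exact g.symm _ _ _
  · have h1 := bil_eq_dotProduct (metricCoeff g e y) (WithLp.toLp 2 x) (WithLp.toLp 2 x)
    rw [star_trivial, ← h1, bil_metricCoeff]
    refine g.pos _ _ ?_
    -- Positivity of g passes to the coefficients because the inverse chart has injective
    -- derivative.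
    have hd := (mdifferentiable_of_mem_atlas (I := 𝓡 n) he).symm
    have hinj := hd.mfderiv_injective (x := y) hy
    intro h0
    have : (WithLp.toLp 2 x : Coord n) = 0 := hinj (h0.trans (map_zero _).symm)
    exact hx (by simpa using this)

theorem isMetricOn_metricCoeff (g : Metr n M) {e : OpenPartialHomeomorph M (Coord n)}
    (he : e ∈ atlas (Coord n) M) : IsMetricOn (metricCoeff g e) e.target :=
  ⟨e.open_target, contDiffOn_metricCoeff g he, fun _ hy => posDef_metricCoeff g he hy⟩

variable [SecondCountableTopology M] [Nonempty M]

/-- The metrics `g` and `h` are `δ`-close at every point, up to second order. -/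
def CloseMetrics (g h : Metr n M) (δ : ℝ) : Prop :=
  ∀ x, JetBound (metricCoeff g (goodChart n x))
    (metricCoeff h (goodChart n x) - metricCoeff g (goodChart n x)) (goodChart n x x) δ

theorem closeMetrics_of_mem_uniformBall {g h : Metr n M} {δ : ℝ} (hδ : 0 ≤ δ)
    (hh : h ∈ uniformBall 2 g δ) : CloseMetrics g h δ := by
  intro x i hi
  have h1 : ENNReal.ofReal (covDerivDiffNorm g h i x) ≤ ENNReal.ofReal δ := by
    refine le_trans ?_ (le_of_lt hh)
    unfold ckDist
    refine le_trans (le_iSup (fun x : M => ENNReal.ofReal (covDerivDiffNorm g h i x)) x) ?_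
    exact Finset.single_le_sum (f := fun i => ⨆ x : M, ENNReal.ofReal (covDerivDiffNorm g h i x))
      (fun _ _ => zero_le) (Finset.mem_range.2 (by omega))
  exact (ENNReal.ofReal_le_ofReal_iff hδ).1 h1

/-- The factor 3 counts the suprema in `ckDist 2`; the margin makes the inequality strict. -/
theorem CloseMetrics.mem_uniformBall {g h : Metr n M} {δ ε : ℝ} (hδ : 0 ≤ δ)
    (hh : CloseMetrics g h δ) (hε : 3 * δ < ε) : h ∈ uniformBall 2 g ε := by
  change ckDist 2 g h < _
  have h1 : ∀ i ∈ Finset.range (2 + 1), ⨆ x : M, ENNReal.ofReal (covDerivDiffNorm g h i x)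
      ≤ ENNReal.ofReal δ := fun i hi => iSup_le fun x => ENNReal.ofReal_le_ofReal
        (hh x i (by have := Finset.mem_range.1 hi; omega))
  refine lt_of_le_of_lt (Finset.sum_le_sum h1) ?_
  rw [Finset.sum_const, Finset.card_range, ← ENNReal.ofReal_nsmul]
  exact (ENNReal.ofReal_lt_ofReal_iff (by linarith)).2 (by simpa using hε)

theorem CloseMetrics.trans {g h k : Metr n M} {δ : ℝ} (hδ0 : 0 ≤ δ) (hδ : δ ≤ 1 / 2)
    (hgh : CloseMetrics g h δ) (hhk : CloseMetrics h k δ) :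
    CloseMetrics g k ((n + 1) ^ 2 * (1121 * δ)) := fun x =>
  JetBound.trans (isMetricOn_metricCoeff g (goodChart_mem_atlas x))
    (isMetricOn_metricCoeff h (goodChart_mem_atlas x))
    (isMetricOn_metricCoeff k (goodChart_mem_atlas x)) (goodChart_mem_target x) hδ0 hδ
    (hgh x) (hhk x)

/-- The sets `uniformBall 2 g ε` are neighborhoods of `g` in the uniform `C²`-topology. -/
theorem uniformBall_mem_nhds (g : Metr n M) {ε : ℝ} (hε : 0 < ε) :
    uniformBall 2 g ε ∈ @nhds _ (uniformTopology n M 2) g := by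
  let _ := uniformTopology n M 2
  -- W plays the role of the interior of the ball. It contains g and lies in the ball, so only its
  -- openness has to be shown.
  let W : Set (Metr n M) := {k | ∃ η : ℝ, 0 < η ∧ uniformBall 2 k η ⊆ uniformBall 2 g ε}
  have hself : ∀ k : Metr n M, ∀ η : ℝ, 0 < η → k ∈ uniformBall 2 k η := by
    intro k η hη
    refine CloseMetrics.mem_uniformBall le_rfl ?_ (by linarith)
    intro x
    have hk := isMetricOn_metricCoeff k (goodChart_mem_atlas x)
    have := JetBoundML.jetBound (δ := 0) (y := goodChart n x x) hk (goodChart_mem_target x)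
      (hk.sub_contDiffOn hk) le_rfl ⟨?_, ?_, ?_⟩
    · simpa using this
    · intro u v
      simp
    · intro w u v
      rw [bil_sub_fun, sub_self]
      simp [cov1]
    · intro e w u v
      rw [bil_sub_fun, sub_self]
      simp [cov2, cov1]
  have hW : IsOpen W := by
    intro k hk
    obtain ⟨η, hη, hsub⟩ := hk
    set C : ℝ := (n + 1) ^ 2 * 1121 with hC
    have hC0 : 0 < C := by positivity
    -- Two steps of size δ give closeness Cδ by `CloseMetrics.trans`, which requires δ ≤ 1/2. Then
    -- 3Cδ ≤ η/2 < η puts the endpoint into the η-ball.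
    set δ := min (1 / 2) (η / (6 * C)) with hδ
    have hδ0 : 0 < δ := lt_min (by norm_num) (by positivity)
    refine ⟨δ, hδ0, fun k₁ hk₁ => ⟨δ, hδ0, fun k₂ hk₂ => hsub ?_⟩⟩
    have := (closeMetrics_of_mem_uniformBall hδ0.le hk₁).trans hδ0.le (min_le_left _ _)
      (closeMetrics_of_mem_uniformBall hδ0.le hk₂)
    refine this.mem_uniformBall (by positivity) ?_
    have h1 : δ ≤ η / (6 * C) := min_le_right _ _
    rw [le_div_iff₀ (by positivity)] at h1
    nlinarith
  refine mem_nhds_iff.2 ⟨W, ?_, hW, ⟨ε, hε, subset_rfl⟩⟩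
  rintro k ⟨η, hη, hsub⟩
  exact hsub (hself k η hη)

variable {g h : Metr n M} {δ : ℝ}

theorem CloseMetrics.abs_scal_sub_le (hδ0 : 0 ≤ δ) (hδ : δ ≤ 1 / 2) (hgh : CloseMetrics g h δ)
    (x : M) : |scal h x - scal g x| ≤ 72 * (n + 1) ^ 2 * δ * (1 + ricciNorm g x) :=
  abs_scalCoeff_sub_le (isMetricOn_metricCoeff g (goodChart_mem_atlas x))
    (isMetricOn_metricCoeff h (goodChart_mem_atlas x)) (goodChart_mem_target x) hδ0 hδ (hgh x)

theorem CloseMetrics.abs_diffNorm_sq_sub_le (hδ : δ ≤ 1 / 2) (hgh : CloseMetrics g h δ)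
    (v : M → ℝ) (x : M) :
    |diffNorm h v x ^ 2 - diffNorm g v x ^ 2| ≤ 2 * δ * diffNorm g v x ^ 2 :=
  abs_tensorNorm_sq_sub_le (isMetricOn_metricCoeff g (goodChart_mem_atlas x))
    (isMetricOn_metricCoeff h (goodChart_mem_atlas x)) (goodChart_mem_target x) hδ (hgh x)
    fun i => pderiv i (v ∘ (goodChart n x).symm) (goodChart n x x)

theorem CloseMetrics.det_bounds (hδ : δ ≤ 1 / 2) (hgh : CloseMetrics g h δ) (x : M) :
    (1 - δ) ^ n * (metricCoeff g (goodChart n x) (goodChart n x x)).det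
        ≤ (metricCoeff h (goodChart n x) (goodChart n x x)).det ∧
      (metricCoeff h (goodChart n x) (goodChart n x x)).det
        ≤ (1 + δ) ^ n * (metricCoeff g (goodChart n x) (goodChart n x x)).det :=
  YamabeMap.det_bounds (isMetricOn_metricCoeff g (goodChart_mem_atlas x))
    (isMetricOn_metricCoeff h (goodChart_mem_atlas x)) (goodChart_mem_target x) hδ (hgh x)

end MetricCoeff

end YamabeMap

namespace YamabeMap

/-! ### Measurability and integrability through the countable family of charts. -/

section Preimage

variable {n : ℕ} {M : Type*} [TopologicalSpace M] [MeasurableSpace M] [BorelSpace M]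

theorem measurableSet_target_inter_preimage (e : OpenPartialHomeomorph M (Coord n)) {s : Set M}
    (hs : MeasurableSet s) : MeasurableSet (e.symm ⁻¹' s ∩ e.target) := by
  have h1 : Measurable (e.target.domRestrict e.symm) :=
    (continuousOn_iff_continuous_domRestrict.1 e.continuousOn_symm).measurable
  have h2 := e.open_target.measurableSet.subtype_image (h1 hs)
  convert h2 using 1
  ext y
  simp [Set.domRestrict, and_comm]

end Preimage

section Index

variable {n : ℕ} {M : Type*} [TopologicalSpace M] [ChartedSpace (Coord n) M]
  [SecondCountableTopology M] [Nonempty M]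

theorem chartIndex_eq_iff (x : M) (k : ℕ) :
    chartIndex n x = k ↔ x ∈ coverSet n M k ∧ ∀ m < k, x ∉ coverSet n M m := by
  classical
  unfold chartIndex
  convert Nat.find_eq_iff (exists_mem_coverSet n x)

theorem measurableSet_chartIndex_eq [MeasurableSpace M] [BorelSpace M] (k : ℕ) :
    MeasurableSet {x : M | chartIndex n x = k} := by
  simp only [chartIndex_eq_iff]
  refine (isOpen_coverSet n M k).measurableSet.inter ?_
  have : {x : M | ∀ m < k, x ∉ coverSet n M m} = ⋂ m, ⋂ (_ : m < k), (coverSet n M m)ᶜ := by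
    ext x
    simp
  change MeasurableSet {x : M | ∀ m < k, x ∉ coverSet n M m}
  rw [this]
  exact MeasurableSet.iInter fun m => MeasurableSet.iInter fun _ =>
    (isOpen_coverSet n M m).measurableSet.compl

theorem iUnion_chartIndex_eq : ⋃ k, {x : M | chartIndex n x = k} = Set.univ := by
  ext x
  simp

/-- Finitely many `coverSet`s cover K, and `chartIndex` picks the smallest admissible index. A
compactly supported integrand thus meets only finitely many pieces. -/
theorem IsCompact.exists_chartIndex_lt {K : Set M} (hK : IsCompact K) :
    ∃ N, ∀ x ∈ K, chartIndex n x < N := by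
  obtain ⟨t, ht⟩ := hK.elim_finite_subcover (fun k => coverSet n M k)
    (fun k => isOpen_coverSet n M k) (fun x _ => Set.mem_iUnion.2 (exists_mem_coverSet n x))
  refine ⟨t.sup id + 1, fun x hx => ?_⟩
  obtain ⟨k, hkt, hk⟩ : ∃ k ∈ t, x ∈ coverSet n M k := by simpa using ht hx
  have h1 : chartIndex n x ≤ k := by
    by_contra hcon
    exact ((chartIndex_eq_iff x _).1 rfl).2 k (by omega) hk
  have h2 : k ≤ t.sup id := Finset.le_sup (f := id) hkt
  omega

/-- A function that agrees, on the set of points with a given chart index, with a function that is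
continuous on the domain of the corresponding chart. -/
def ChartwiseContinuous (n : ℕ) {M : Type*} [TopologicalSpace M] [ChartedSpace (Coord n) M]
    [SecondCountableTopology M] [Nonempty M] (f : M → ℝ) : Prop :=
  ∀ k, ∃ F : M → ℝ, ContinuousOn F (coverChart n M k).source ∧
    ∀ x, chartIndex n x = k → f x = F x

namespace ChartwiseContinuous

variable {f₁ f₂ : M → ℝ}

theorem of_continuous {f : M → ℝ} (hf : Continuous f) : ChartwiseContinuous n f :=
  fun _ => ⟨f, hf.continuousOn, fun _ _ => rfl⟩

theorem add (h₁ : ChartwiseContinuous n f₁) (h₂ : ChartwiseContinuous n f₂) :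
    ChartwiseContinuous n fun x => f₁ x + f₂ x := fun k => by
  obtain ⟨F₁, c₁, e₁⟩ := h₁ k
  obtain ⟨F₂, c₂, e₂⟩ := h₂ k
  exact ⟨fun x => F₁ x + F₂ x, c₁.add c₂, fun x hx => by simp only [e₁ x hx, e₂ x hx]⟩

theorem mul (h₁ : ChartwiseContinuous n f₁) (h₂ : ChartwiseContinuous n f₂) :
    ChartwiseContinuous n fun x => f₁ x * f₂ x := fun k => by
  obtain ⟨F₁, c₁, e₁⟩ := h₁ k
  obtain ⟨F₂, c₂, e₂⟩ := h₂ k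
  exact ⟨fun x => F₁ x * F₂ x, c₁.mul c₂, fun x hx => by simp only [e₁ x hx, e₂ x hx]⟩

theorem comp {φ : ℝ → ℝ} (hφ : Continuous φ) (h₁ : ChartwiseContinuous n f₁) :
    ChartwiseContinuous n fun x => φ (f₁ x) := fun k => by
  obtain ⟨F₁, c₁, e₁⟩ := h₁ k
  exact ⟨fun x => φ (F₁ x), hφ.comp_continuousOn c₁, fun x hx => by simp only [e₁ x hx]⟩

/-- On the points of chart index k the chart `goodChart` is the fixed chart `coverChart n M k`, so
continuity in each chart is enough. Independence of the chart is not used. -/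
theorem of_coordinates {f : M → ℝ} (Φ : OpenPartialHomeomorph M (Coord n) → Coord n → ℝ)
    (hf : ∀ x, f x = Φ (goodChart n x) (goodChart n x x))
    (hΦ : ∀ e ∈ atlas (Coord n) M, ContinuousOn (Φ e) e.target) : ChartwiseContinuous n f := by
  intro k
  refine ⟨fun x => Φ (coverChart n M k) (coverChart n M k x),
    (hΦ _ (coverChart_mem_atlas k)).comp (coverChart n M k).continuousOn
      (coverChart n M k).mapsTo, fun x hx => ?_⟩
  rw [hf, goodChart, hx]

variable [MeasurableSpace M] [BorelSpace M]

theorem aestronglyMeasurable {f : M → ℝ} (hf : ChartwiseContinuous n f) (μ : Measure M) :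
    AEStronglyMeasurable f μ := by
  rw [← Measure.restrict_univ (μ := μ), ← iUnion_chartIndex_eq (n := n),
    aestronglyMeasurable_iUnion_iff]
  intro k
  obtain ⟨F, hF, e⟩ := hf k
  have h1 : ContinuousOn F {x : M | chartIndex n x = k} := by
    refine hF.mono fun x hx => ?_
    have := mem_goodChart_source n x
    rwa [goodChart, hx] at this
  refine (h1.aestronglyMeasurable (measurableSet_chartIndex_eq k)).congr ?_
  filter_upwards [ae_restrict_mem (measurableSet_chartIndex_eq (n := n) (M := M) k)] with x hx
  exact (e x hx).symm

/-- The piece of index k lies in a compact subset of the k-th chart domain, where the continuous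
representative F is bounded. -/
theorem integrableOn {f : M → ℝ} (hf : ChartwiseContinuous n f) {μ : Measure M} {k : ℕ}
    (hμ : μ {x : M | chartIndex n x = k} < ⊤) : IntegrableOn f {x : M | chartIndex n x = k} μ := by
  obtain ⟨F, hF, e⟩ := hf k
  obtain ⟨K, hK, hUK, hKs⟩ := exists_isCompact_coverSet n M k
  obtain ⟨C, hC⟩ := hK.exists_bound_of_continuousOn (hF.mono hKs)
  refine IntegrableOn.of_bound hμ (hf.aestronglyMeasurable μ).restrict C ?_
  filter_upwards [ae_restrict_mem (measurableSet_chartIndex_eq (n := n) (M := M) k)] with x hx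
  rw [e x hx]
  exact hC x (hUK (((chartIndex_eq_iff x k).1 hx).1))

theorem integrable {f : M → ℝ} (hf : ChartwiseContinuous n f) {μ : Measure M}
    (hμ : ∀ k, μ {x : M | chartIndex n x = k} < ⊤) {K : Set M} (hK : IsCompact K)
    (h0 : ∀ x ∉ K, f x = 0) : Integrable f μ := by
  obtain ⟨N, hN⟩ := IsCompact.exists_chartIndex_lt (n := n) hK
  have h1 : IntegrableOn f (⋃ k ∈ Finset.range N, {x : M | chartIndex n x = k}) μ :=
    integrableOn_finset_iUnion.2 fun k _ => hf.integrableOn (hμ k)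
  refine (integrableOn_iff_integrable_of_support_subset ?_).1 h1
  intro x hx
  have hxK : x ∈ K := by
    by_contra hcon
    exact hx (h0 x hcon)
  simpa using hN x hxK

end ChartwiseContinuous

end Index

/-! ### Regularity of curvature and of the gradient norm on M. -/

section Regularity

variable {n : ℕ} {M : Type*} [TopologicalSpace M] [ChartedSpace (Coord n) M]
  [IsManifold (𝓡 n) ∞ M] [SecondCountableTopology M] [Nonempty M]

theorem chartwiseContinuous_scal (g : Metr n M) : ChartwiseContinuous n (scal g) :=
  .of_coordinates (fun e => scalCoeff (metricCoeff g e)) (fun _ => rfl) fun _ he =>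
    (isMetricOn_metricCoeff g he).contDiffOn_scalCoeff.continuousOn

theorem chartwiseContinuous_ricciNorm (g : Metr n M) : ChartwiseContinuous n (ricciNorm g) :=
  .of_coordinates (fun e y => tensorNorm (metricCoeff g e y)
    (fun I : Fin 2 → Fin n => ricciCoeff (metricCoeff g e) (I 0) (I 1) y)) (fun _ => rfl)
    fun _ he => (isMetricOn_metricCoeff g he).continuousOn_tensorNorm fun _ =>
      ((isMetricOn_metricCoeff g he).contDiffOn_ricciCoeff _ _).continuousOn

theorem chartwiseContinuous_diffNorm (g : Metr n M) {v : M → ℝ}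
    (hv : ContMDiff (𝓡 n) 𝓘(ℝ) ∞ v) : ChartwiseContinuous n (diffNorm g v) :=
  .of_coordinates (fun e y => tensorNorm (metricCoeff g e y)
    (fun I : Fin 1 → Fin n => pderiv (I 0) (v ∘ e.symm) y)) (fun _ => rfl) fun e he => by
      refine (isMetricOn_metricCoeff g he).continuousOn_tensorNorm fun I => ?_
      have h1 : ContMDiffOn 𝓘(ℝ, Coord n) (𝓡 n) ∞ e.symm e.target :=
        contMDiffOn_symm_of_mem_maximalAtlas (IsManifold.subset_maximalAtlas he)
      have h2 : ContDiffOn ℝ ∞ (v ∘ e.symm) e.target :=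
        contMDiffOn_iff_contDiffOn.1 (hv.comp_contMDiffOn h1)
      exact (ContDiffOn.pderiv e.open_target h2 _).continuousOn

theorem diffNorm_eq_zero (g : Metr n M) {v : M → ℝ} {x : M} (hx : x ∉ tsupport v) :
    diffNorm g v x = 0 := by
  have hs := mem_goodChart_source n x
  have h1 : v =ᶠ[𝓝 x] 0 := notMem_tsupport_iff_eventuallyEq.1 hx
  have h2 : (v ∘ (goodChart n x).symm) =ᶠ[𝓝 (goodChart n x x)] fun _ => 0 := by
    have := (goodChart n x).continuousAt_symm ((goodChart n x).map_source hs)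
    rw [ContinuousAt, (goodChart n x).left_inv hs] at this
    exact this.eventually h1
  unfold diffNorm tensorNorm pderiv
  rw [h2.fderiv_eq]
  simp

end Regularity

/-! ### The Riemannian measure and its dependence on the metric. -/

section RiemMeasure

variable {n : ℕ} {M : Type*} [TopologicalSpace M] [ChartedSpace (Coord n) M]
  [IsManifold (𝓡 n) ∞ M] [SecondCountableTopology M] [Nonempty M] [MeasurableSpace M] [BorelSpace M]
  {g h : Metr n M}

theorem riemMeasure_apply (g : Metr n M) {s : Set M} (hs : MeasurableSet s) :
    riemMeasure g s = ∑' k, ∫⁻ y in (coverChart n M k).symm ⁻¹' (s ∩ {x | chartIndex n x = k}) ∩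
      (coverChart n M k).target,
        ENNReal.ofReal (Real.sqrt (metricCoeff g (coverChart n M k) y).det) := by
  rw [riemMeasure, Measure.sum_apply _ hs]
  congr 1
  funext k
  set e := coverChart n M k
  have hS := measurableSet_chartIndex_eq (n := n) (M := M) k
  have hm : AEMeasurable e.symm ((volume : Measure (Coord n)).restrict e.target) :=
    e.continuousOn_symm.aemeasurable e.open_target.measurableSet
  have hnull : NullMeasurableSet (e.symm ⁻¹' (s ∩ {x | chartIndex n x = k}))
      ((volume : Measure (Coord n)).restrict e.target) := hm.nullMeasurable (hs.inter hS)
  rw [Measure.restrict_apply hs, Measure.map_apply_of_aemeasurable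
    (hm.mono_ac (withDensity_absolutelyContinuous _ _)) (hs.inter hS), withDensity_apply₀ _ hnull,
    Measure.restrict_restrict₀ hnull]

/-- Only the k-th summand sees this piece. The corresponding coordinate set is relatively compact in
the chart target, so both its volume and the density are bounded there. -/
theorem riemMeasure_chartIndex_eq_lt_top (g : Metr n M) (k : ℕ) :
    riemMeasure g {x : M | chartIndex n x = k} < ⊤ := by
  rw [riemMeasure_apply g (measurableSet_chartIndex_eq k), tsum_eq_single k]
  · set e := coverChart n M k with he
    obtain ⟨K, hK, hUK, hKs⟩ := exists_isCompact_coverSet n M k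
    have hc : ContinuousOn (fun y => Real.sqrt (metricCoeff g e y).det) e.target :=
      (ContDiffOn.det_matrix (contDiffOn_metricCoeff g (coverChart_mem_atlas k))).continuousOn.sqrt
    have hK' : IsCompact (e '' K) := hK.image_of_continuousOn (e.continuousOn.mono hKs)
    have hsub : e '' K ⊆ e.target := by
      rintro _ ⟨x, hx, rfl⟩
      exact e.map_source (hKs hx)
    obtain ⟨C, hC⟩ := hK'.exists_bound_of_continuousOn (hc.mono hsub)
    set A := e.symm ⁻¹' ({x | chartIndex n x = k} ∩ {x | chartIndex n x = k}) ∩ e.target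
    have hA : MeasurableSet A := measurableSet_target_inter_preimage e
      ((measurableSet_chartIndex_eq k).inter (measurableSet_chartIndex_eq k))
    have hAK : A ⊆ e '' K := by
      rintro y ⟨⟨hy, -⟩, hyt⟩
      exact ⟨e.symm y, hUK ((chartIndex_eq_iff _ k).1 hy).1, e.right_inv hyt⟩
    calc ∫⁻ y in A, ENNReal.ofReal (Real.sqrt (metricCoeff g e y).det)
        ≤ ∫⁻ y in A, ENNReal.ofReal C := by
          refine setLIntegral_mono' hA fun y hy => ENNReal.ofReal_le_ofReal ?_
          exact (le_abs_self _).trans (hC y (hAK hy))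
      _ = ENNReal.ofReal C * volume A := by simp
      _ < ⊤ := ENNReal.mul_lt_top ENNReal.ofReal_lt_top
          (lt_of_le_of_lt (measure_mono hAK) hK'.measure_lt_top)
  · intro j hj
    have : ({x : M | chartIndex n x = k} ∩ {x | chartIndex n x = j}) = ∅ := by
      ext x
      simp only [Set.mem_inter_iff, Set.mem_ofPred_eq, Set.mem_empty_iff_false, iff_false, not_and]
      rintro h1 h2
      exact hj (h2.symm.trans h1)
    rw [this]
    simp

/-- Both measures are assembled from the same charts and pieces, so a pointwise comparison of
densities suffices. -/
theorem riemMeasure_le_smul {c : ℝ} (hc : 0 ≤ c)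
    (hgh : ∀ x : M, Real.sqrt (metricCoeff h (goodChart n x) (goodChart n x x)).det
      ≤ c * Real.sqrt (metricCoeff g (goodChart n x) (goodChart n x x)).det) :
    riemMeasure h ≤ ENNReal.ofReal c • riemMeasure g := by
  refine Measure.le_iff.2 fun s hs => ?_
  rw [Measure.smul_apply, smul_eq_mul, riemMeasure_apply h hs, riemMeasure_apply g hs,
    ← ENNReal.tsum_mul_left]
  refine ENNReal.tsum_le_tsum fun k => ?_
  rw [← lintegral_const_mul' _ _ ENNReal.ofReal_ne_top]
  refine setLIntegral_mono' (measurableSet_target_inter_preimage _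
    (hs.inter (measurableSet_chartIndex_eq k))) ?_
  rintro y ⟨⟨-, hy⟩, hyt⟩
  rw [← ENNReal.ofReal_mul hc]
  refine ENNReal.ofReal_le_ofReal ?_
  have := hgh ((coverChart n M k).symm y)
  rw [goodChart, hy, (coverChart n M k).right_inv hyt] at this
  exact this

/-- Quantitative continuity of all the geometric quantities that enter the Yamabe functional. -/
theorem exists_closeMetrics_bounds (n : ℕ) {η : ℝ} (hη : 0 < η) : ∃ δ : ℝ, 0 < δ ∧
    ∀ {M : Type*} [TopologicalSpace M] [ChartedSpace (Coord n) M] [IsManifold (𝓡 n) ∞ M]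
      [SecondCountableTopology M] [Nonempty M] [MeasurableSpace M] [BorelSpace M] {g h : Metr n M},
      CloseMetrics g h δ →
      ENNReal.ofReal (1 - η) • riemMeasure g ≤ riemMeasure h ∧
      riemMeasure h ≤ ENNReal.ofReal (1 + η) • riemMeasure g ∧
      (∀ x, |scal h x - scal g x| ≤ η * (1 + ricciNorm g x)) ∧
      ∀ v x, |diffNorm h v x ^ 2 - diffNorm g v x ^ 2| ≤ η * diffNorm g v x ^ 2 := by
  have c1 : ∀ᶠ δ in 𝓝[>] (0 : ℝ), √((1 + δ) ^ n) < 1 + η := by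
    have : ContinuousAt (fun δ : ℝ => √((1 + δ) ^ n)) 0 := by fun_prop
    exact (this.eventually_lt continuousAt_const (by simpa using hη)).filter_mono nhdsWithin_le_nhds
  have c2 : ∀ᶠ δ in 𝓝[>] (0 : ℝ), 1 < (1 + η) * √((1 - δ) ^ n) := by
    have : ContinuousAt (fun δ : ℝ => (1 + η) * √((1 - δ) ^ n)) 0 := by fun_prop
    exact (continuousAt_const.eventually_lt this (by simpa using hη)).filter_mono nhdsWithin_le_nhds
  have c3 : ∀ᶠ δ in 𝓝[>] (0 : ℝ), 72 * (n + 1) ^ 2 * δ < η := by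
    have : ContinuousAt (fun δ : ℝ => 72 * ((n : ℝ) + 1) ^ 2 * δ) 0 := by fun_prop
    exact (this.eventually_lt continuousAt_const (by simpa using hη)).filter_mono nhdsWithin_le_nhds
  have c4 : ∀ᶠ δ in 𝓝[>] (0 : ℝ), δ < 1 / 2 :=
    (eventually_lt_nhds (by norm_num)).filter_mono nhdsWithin_le_nhds
  have c5 : ∀ᶠ δ in 𝓝[>] (0 : ℝ), 0 < δ := eventually_mem_nhdsWithin
  obtain ⟨δ, h1, h2, h3, h4, h5⟩ := (c1.and (c2.and (c3.and (c4.and c5)))).exists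
  refine ⟨δ, h5, fun {M} _ _ _ _ _ _ _ {g h} hgh => ⟨?_, ?_, fun x => ?_, fun v x => ?_⟩⟩
  -- The lower bound follows from the upper bound with g and h exchanged, since (1 - η)(1 + η) ≤ 1.
  · have hle : riemMeasure g ≤ ENNReal.ofReal (1 + η) • riemMeasure h := by
      refine riemMeasure_le_smul (by linarith) fun x => ?_
      have hd := (hgh.det_bounds h4.le x).1
      have hs := Real.sqrt_le_sqrt hd
      rw [Real.sqrt_mul (pow_nonneg (by linarith) _)] at hs
      have e0 := Real.sqrt_nonneg (metricCoeff g (goodChart n x) (goodChart n x x)).det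
      nlinarith
    refine Measure.le_iff'.2 fun s => ?_
    have := Measure.le_iff'.1 hle s
    simp only [Measure.smul_apply, smul_eq_mul] at this ⊢
    calc ENNReal.ofReal (1 - η) * riemMeasure g s
        ≤ ENNReal.ofReal (1 - η) * (ENNReal.ofReal (1 + η) * riemMeasure h s) := by gcongr
      _ ≤ 1 * riemMeasure h s := by
        rw [← mul_assoc, ← ENNReal.ofReal_mul' (by linarith)]
        gcongr
        rw [ENNReal.ofReal_le_one]
        nlinarith
      _ = _ := one_mul _
  · refine riemMeasure_le_smul (by linarith) fun x => ?_
    have hd := (hgh.det_bounds h4.le x).2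
    have hs := Real.sqrt_le_sqrt hd
    rw [Real.sqrt_mul (pow_nonneg (by linarith) _)] at hs
    exact hs.trans (mul_le_mul_of_nonneg_right h1.le (Real.sqrt_nonneg _))
  · refine (hgh.abs_scal_sub_le h5.le h4.le x).trans (mul_le_mul_of_nonneg_right h3.le ?_)
    have : 0 ≤ ricciNorm g x := Real.sqrt_nonneg _
    linarith
  · refine (hgh.abs_diffNorm_sq_sub_le h4.le v x).trans (mul_le_mul_of_nonneg_right ?_ (sq_nonneg _))
    have hn : (1 : ℝ) ≤ (n + 1) ^ 2 := one_le_pow₀ (by linarith [(Nat.cast_nonneg n : (0 : ℝ) ≤ n)])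
    nlinarith

end RiemMeasure

end YamabeMap

namespace YamabeMap

/-! ### Stability of integrals and Lᵖ-norms, and Hölder's inequality. -/

section Integrals

variable {α : Type*} [MeasurableSpace α] {μ ν : Measure α} {η : ℝ}

theorem integral_le_mul_integral (hη0 : 0 ≤ η) (h : ν ≤ ENNReal.ofReal η • μ) {p : α → ℝ}
    (hp : ∀ x, 0 ≤ p x) (hi : Integrable p μ) : ∫ x, p x ∂ν ≤ η * ∫ x, p x ∂μ := by
  have h1 : Integrable p (ENNReal.ofReal η • μ) := hi.smul_measure ENNReal.ofReal_ne_top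
  have h2 := integral_mono_measure h (Filter.Eventually.of_forall hp) h1
  rwa [integral_smul_measure, ENNReal.toReal_ofReal hη0, smul_eq_mul] at h2

theorem mul_integral_le_integral (hη0 : 0 ≤ η) (h : ENNReal.ofReal η • μ ≤ ν) {p : α → ℝ}
    (hp : ∀ x, 0 ≤ p x) (hi : Integrable p ν) : η * ∫ x, p x ∂μ ≤ ∫ x, p x ∂ν := by
  have h2 := integral_mono_measure h (Filter.Eventually.of_forall hp) hi
  rwa [integral_smul_measure, ENNReal.toReal_ofReal hη0, smul_eq_mul] at h2

/-- Stability of integrals under a simultaneous perturbation of measure and integrand. -/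
theorem abs_integral_sub_integral_le (hη0 : 0 ≤ η) (hη1 : η ≤ 1)
    (h1 : ENNReal.ofReal (1 - η) • μ ≤ ν) (h2 : ν ≤ ENNReal.ofReal (1 + η) • μ) {f F φ : α → ℝ}
    (hf : Integrable f μ) (hF : Integrable F μ) (hφ : AEStronglyMeasurable φ ν)
    (hfF : ∀ x, |f x| ≤ F x) (hφf : ∀ x, |φ x - f x| ≤ η * F x) :
    |∫ x, φ x ∂ν - ∫ x, f x ∂μ| ≤ 3 * η * ∫ x, F x ∂μ := by
  have hmono : ∀ {p : α → ℝ}, Integrable p μ → Integrable p ν := fun hp =>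
    (hp.smul_measure ENNReal.ofReal_ne_top).mono_measure h2
  have hF0 : ∀ x, 0 ≤ F x := fun x => (abs_nonneg _).trans (hfF x)
  have hφi : Integrable φ ν := by
    refine ((hmono hF).const_mul 2).mono' hφ (Filter.Eventually.of_forall fun x => ?_)
    rw [Real.norm_eq_abs]
    have e1 := abs_le.1 (hfF x)
    have e2 := abs_le.1 (hφf x)
    have e3 : η * F x ≤ 1 * F x := mul_le_mul_of_nonneg_right hη1 (hF0 x)
    rw [abs_le]
    constructor <;> linarith
  -- Comparison of measures needs nonnegative integrands, so it is applied to F + f and F - f, half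
  -- of whose difference is f. This costs η∫F. Replacing f by φ costs η(1 + η)∫F ≤ 2η∫F, hence the
  -- constant 3η.
  have hp0 : ∀ x, 0 ≤ F x + f x := fun x => by linarith [(abs_le.1 (hfF x)).1]
  have hm0 : ∀ x, 0 ≤ F x - f x := fun x => by linarith [(abs_le.1 (hfF x)).2]
  have hpi : Integrable (fun x => F x + f x) μ := hF.add hf
  have hmi : Integrable (fun x => F x - f x) μ := hF.sub hf
  have p1 := integral_le_mul_integral (by linarith) h2 hp0 hpi
  have p2 := mul_integral_le_integral (by linarith) h1 hp0 (hmono hpi)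
  have m1 := integral_le_mul_integral (by linarith) h2 hm0 hmi
  have m2 := mul_integral_le_integral (by linarith) h1 hm0 (hmono hmi)
  have F1 := integral_le_mul_integral (by linarith) h2 hF0 hF
  have F0 : 0 ≤ ∫ x, F x ∂μ := integral_nonneg hF0
  rw [integral_add hF hf, integral_add (hmono hF) (hmono hf)] at p1 p2
  rw [integral_sub hF hf, integral_sub (hmono hF) (hmono hf)] at m1 m2
  have d : |∫ x, φ x ∂ν - ∫ x, f x ∂ν| ≤ η * ∫ x, F x ∂ν := by
    rw [← integral_sub hφi (hmono hf), ← integral_const_mul]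
    refine (abs_integral_le_integral_abs).trans ?_
    exact integral_mono (hφi.sub (hmono hf)).abs ((hmono hF).const_mul η) hφf
  have d' : η * ∫ x, F x ∂ν ≤ η * ((1 + η) * ∫ x, F x ∂μ) := by gcongr
  have d'' : η * ((1 + η) * ∫ x, F x ∂μ) ≤ η * (2 * ∫ x, F x ∂μ) := by gcongr; linarith
  have d3 := abs_le.1 d
  rw [abs_le]
  constructor <;> linarith

/-- Stability of `Lᵖ`-norms, `p ≥ 2`, under a perturbation of the measure. -/
theorem eLpNorm_toReal_sq_bounds (hη0 : 0 ≤ η) (hη1 : η < 1)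
    (h1 : ENNReal.ofReal (1 - η) • μ ≤ ν) (h2 : ν ≤ ENNReal.ofReal (1 + η) • μ) (v : α → ℝ)
    {p : ℝ} (hp : 2 ≤ p) :
    (1 - η) * (eLpNorm v (ENNReal.ofReal p) μ).toReal ^ 2
        ≤ (eLpNorm v (ENNReal.ofReal p) ν).toReal ^ 2 ∧
      (eLpNorm v (ENNReal.ofReal p) ν).toReal ^ 2
        ≤ (1 + η) * (eLpNorm v (ENNReal.ofReal p) μ).toReal ^ 2 := by
  have e1 := eLpNorm_mono_measure (p := ENNReal.ofReal p) v h1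
  have e2 := eLpNorm_mono_measure (p := ENNReal.ofReal p) v h2
  have hr : (1 / ENNReal.ofReal p).toReal = 1 / p := by
    rw [ENNReal.toReal_div, ENNReal.toReal_one, ENNReal.toReal_ofReal (by linarith)]
  rw [eLpNorm_smul_measure_of_ne_top ENNReal.ofReal_ne_top, hr, smul_eq_mul] at e1 e2
  rw [ENNReal.ofReal_rpow_of_pos (by linarith)] at e1 e2
  set a := (1 - η) ^ (1 / p) with ha
  set b := (1 + η) ^ (1 / p) with hb
  have ha0 : 0 < a := Real.rpow_pos_of_pos (by linarith) _
  have hb0 : 0 < b := Real.rpow_pos_of_pos (by linarith) _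
  -- Scaling the measure by c scales the squared norm by c^(2/p). As 2/p ≤ 1, this power lies
  -- between 1 and c.
  have hexp : 1 / p * 2 ≤ 1 := by
    rw [div_mul_eq_mul_div, one_mul, div_le_one (by linarith)]
    exact hp
  have hexp0 : 0 ≤ 1 / p * 2 := by positivity
  have ha2 : 1 - η ≤ a ^ 2 := by
    rw [ha, ← Real.rpow_natCast, ← Real.rpow_mul (by linarith)]
    exact Real.self_le_rpow_of_le_one (by linarith) (by linarith) (by exact_mod_cast hexp)
  have hb2 : b ^ 2 ≤ 1 + η := by
    rw [hb, ← Real.rpow_natCast, ← Real.rpow_mul (by linarith)]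
    exact Real.rpow_le_self_of_one_le (by linarith) (by exact_mod_cast hexp)
  -- The two norms are infinite simultaneously, and then `toReal` makes both sides 0.
  by_cases ht : eLpNorm v (ENNReal.ofReal p) μ = ⊤
  · have ht' : eLpNorm v (ENNReal.ofReal p) ν = ⊤ := by
      rw [ht, ENNReal.mul_top (by simpa using ha0)] at e1
      exact top_le_iff.1 e1
    simp [ht, ht']
  · have ht' : eLpNorm v (ENNReal.ofReal p) ν ≠ ⊤ :=
      ne_top_of_le_ne_top (ENNReal.mul_ne_top ENNReal.ofReal_ne_top ht) e2
    have r1 := ENNReal.toReal_mono ht' e1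
    have r2 := ENNReal.toReal_mono (ENNReal.mul_ne_top ENNReal.ofReal_ne_top ht) e2
    rw [ENNReal.toReal_mul, ENNReal.toReal_ofReal ha0.le] at r1
    rw [ENNReal.toReal_mul, ENNReal.toReal_ofReal hb0.le] at r2
    set X := (eLpNorm v (ENNReal.ofReal p) μ).toReal
    have hX : 0 ≤ X := ENNReal.toReal_nonneg
    constructor
    · calc (1 - η) * X ^ 2 ≤ a ^ 2 * X ^ 2 := by gcongr
        _ = (a * X) ^ 2 := by ring
        _ ≤ _ := by gcongr
    · calc _ ≤ (b * X) ^ 2 := by gcongr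
        _ = b ^ 2 * X ^ 2 := by ring
        _ ≤ _ := by gcongr

/-- Hölder's inequality with exponents `n / 2`, `2n / (n - 2)`, `2n / (n - 2)`. -/
theorem integral_mul_sq_le {r p : ℝ} (hr : 0 < r) (hp : 0 < p) (hrp : r⁻¹ + 2 * p⁻¹ = 1)
    {w v : α → ℝ} (hw0 : ∀ x, 0 ≤ w x) (hw : AEStronglyMeasurable w μ)
    (hv : AEStronglyMeasurable v μ) (hw' : eLpNorm w (ENNReal.ofReal r) μ ≠ ⊤)
    (hv' : eLpNorm v (ENNReal.ofReal p) μ ≠ ⊤) :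
    ∫ x, w x * v x ^ 2 ∂μ ≤ (eLpNorm w (ENNReal.ofReal r) μ).toReal
      * (eLpNorm v (ENNReal.ofReal p) μ).toReal ^ 2 := by
  have t1 : ENNReal.HolderTriple (ENNReal.ofReal p) (ENNReal.ofReal p) (ENNReal.ofReal (p / 2)) := by
    constructor
    rw [← ENNReal.ofReal_inv_of_pos hp, ← ENNReal.ofReal_inv_of_pos (by positivity),
      ← ENNReal.ofReal_add (by positivity) (by positivity)]
    congr 1
    field_simp
    norm_num
  have t2 : ENNReal.HolderTriple (ENNReal.ofReal r) (ENNReal.ofReal (p / 2)) 1 := by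
    constructor
    rw [← ENNReal.ofReal_inv_of_pos hr, ← ENNReal.ofReal_inv_of_pos (by positivity),
      ← ENNReal.ofReal_add (by positivity) (by positivity), inv_one, ← ENNReal.ofReal_one]
    congr 1
    rw [← hrp]
    field_simp
  have b1 := eLpNorm_smul_le_mul_eLpNorm (p := ENNReal.ofReal p) (q := ENNReal.ofReal p)
    (r := ENNReal.ofReal (p / 2)) hv hv
  have b2 := eLpNorm_smul_le_mul_eLpNorm (p := ENNReal.ofReal r) (q := ENNReal.ofReal (p / 2))
    (r := 1) (hv.smul hv) hw
  have b3 := b2.trans (mul_le_mul_right b1 _)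
  rw [eLpNorm_one_eq_lintegral_enorm] at b3
  have b4 := ENNReal.toReal_mono (ENNReal.mul_ne_top hw' (ENNReal.mul_ne_top hv' hv')) b3
  rw [← integral_norm_eq_lintegral_enorm (hw.smul (hv.smul hv)), ENNReal.toReal_mul,
    ENNReal.toReal_mul, ← pow_two] at b4
  refine le_trans (le_of_eq ?_) b4
  refine integral_congr_ae (Filter.Eventually.of_forall fun x => ?_)
  simp only [Pi.smul_apply', Pi.mul_apply, smul_eq_mul, Real.norm_eq_abs]
  rw [abs_of_nonneg (mul_nonneg (hw0 x) (mul_self_nonneg (v x))), pow_two]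

end Integrals

/-! ### Numerical constants and the absorption argument. -/

section Constants

variable {n : ℕ}

theorem gradientCoeff_nonneg (hn : 3 ≤ n) : 0 ≤ 4 * ((n : ℝ) - 1) / ((n : ℝ) - 2) := by
  have : (3 : ℝ) ≤ n := by exact_mod_cast hn
  exact div_nonneg (by linarith) (by linarith)

theorem two_le_exponent (hn : 3 ≤ n) : 2 ≤ 2 * (n : ℝ) / ((n : ℝ) - 2) := by
  have : (3 : ℝ) ≤ n := by exact_mod_cast hn
  rw [le_div_iff₀ (by linarith)]
  linarith

/-- The error 3ηI is at most 3ηC(Q + 2WN), and its Q-part is absorbed: Q' ≥ (1 - 3ηC)Q - 6ηCWN ≥ z'N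
- η(3C|z'| + 6CW)N. On the other side zN' ≤ zN + η|z|N. The constant b collects the coefficients of
ηN, and the gap z' - z pays for them. -/
theorem lower_energy_estimate {Q Q' I N N' C W z z' η b : ℝ} (hη : 0 ≤ η) (hC : 0 ≤ C)
    (hN : 0 ≤ N) (hηC : 3 * η * C ≤ 1 / 2) (hb : b = 3 * C * |z'| + 6 * C * W + |z|)
    (hηb : η * b ≤ z' - z) (hQ : z' * N ≤ Q) (hI : I ≤ C * (Q + 2 * (W * N)))
    (hQ' : |Q' - Q| ≤ 3 * η * I) (hN1 : (1 - η) * N ≤ N') (hN2 : N' ≤ (1 + η) * N) :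
    z * N' ≤ Q' := by
  have h4 := (abs_le.1 hQ').1
  have h5 : |z * (N' - N)| ≤ |z| * (η * N) := by
    rw [abs_mul]
    refine mul_le_mul_of_nonneg_left (abs_le.2 ⟨?_, ?_⟩) (abs_nonneg z) <;> linarith
  have h6 := (abs_le.1 h5).2
  have h7 : 3 * η * I ≤ 3 * η * (C * (Q + 2 * (W * N))) :=
    mul_le_mul_of_nonneg_left hI (by linarith)
  have h8 : (1 - 3 * η * C) * (z' * N) ≤ (1 - 3 * η * C) * Q :=
    mul_le_mul_of_nonneg_left hQ (by linarith)
  have h9 : 3 * η * C * (z' * N) ≤ 3 * η * C * (|z'| * N) := by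
    have := le_abs_self z'
    gcongr
  have h10 : η * b * N ≤ (z' - z) * N := mul_le_mul_of_nonneg_right hηb hN
  rw [hb] at h10
  linarith

end Constants

/-! ### Semicontinuity estimates for the Yamabe functional. -/

section Functional

variable {n : ℕ} {M : Type*} [TopologicalSpace M] [ChartedSpace (Coord n) M]
  [IsManifold (𝓡 n) ∞ M] [SecondCountableTopology M] [Nonempty M] {g h : Metr n M} {v : M → ℝ}

/-- The integrand of the Yamabe functional. -/
noncomputable def energyDensity (g : Metr n M) (v : M → ℝ) (x : M) : ℝ :=
  4 * ((n : ℝ) - 1) / ((n : ℝ) - 2) * diffNorm g v x ^ 2 + scal g x * v x ^ 2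

/-- A pointwise bound for the integrand of the Yamabe functional and for its variation. -/
noncomputable def energyBound (g : Metr n M) (v : M → ℝ) (x : M) : ℝ :=
  4 * ((n : ℝ) - 1) / ((n : ℝ) - 2) * diffNorm g v x ^ 2
    + (1 + ricciNorm g x + |scal g x|) * v x ^ 2

theorem ricciNorm_nonneg (g : Metr n M) (x : M) : 0 ≤ ricciNorm g x := Real.sqrt_nonneg _

theorem chartwiseContinuous_energyDensity (g : Metr n M) (hv : v ∈ testFunctions n M) :
    ChartwiseContinuous n (energyDensity g v) :=
  ((chartwiseContinuous_diffNorm g hv.1).comp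
    (φ := fun t => 4 * ((n : ℝ) - 1) / ((n : ℝ) - 2) * t ^ 2) (by fun_prop)).add
  ((chartwiseContinuous_scal g).mul ((ChartwiseContinuous.of_continuous hv.1.continuous).comp
    (φ := fun t => t ^ 2) (by fun_prop)))

theorem chartwiseContinuous_energyBound (g : Metr n M) (hv : v ∈ testFunctions n M) :
    ChartwiseContinuous n (energyBound g v) :=
  ((chartwiseContinuous_diffNorm g hv.1).comp
    (φ := fun t => 4 * ((n : ℝ) - 1) / ((n : ℝ) - 2) * t ^ 2) (by fun_prop)).add
  ((((chartwiseContinuous_ricciNorm g).comp (φ := fun t => 1 + t) (by fun_prop)).add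
    ((chartwiseContinuous_scal g).comp (φ := fun t => |t|) continuous_abs)).mul
    ((ChartwiseContinuous.of_continuous hv.1.continuous).comp (φ := fun t => t ^ 2) (by fun_prop)))

theorem abs_energyDensity_le (hn : 3 ≤ n) (x : M) : |energyDensity g v x| ≤ energyBound g v x := by
  have h1 := mul_nonneg (gradientCoeff_nonneg hn) (sq_nonneg (diffNorm g v x))
  have h2 : |scal g x * v x ^ 2| = |scal g x| * v x ^ 2 := by
    rw [abs_mul, abs_of_nonneg (sq_nonneg (v x))]
  have h3 := mul_nonneg (ricciNorm_nonneg g x) (sq_nonneg (v x))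
  have h4 := sq_nonneg (v x)
  refine (abs_add_le _ _).trans ?_
  rw [abs_of_nonneg h1, h2, energyBound]
  linarith

theorem abs_energyDensity_sub_le (hn : 3 ≤ n) {η : ℝ} (hη : 0 ≤ η)
    (hs : ∀ x, |scal h x - scal g x| ≤ η * (1 + ricciNorm g x))
    (hd : ∀ v x, |diffNorm h v x ^ 2 - diffNorm g v x ^ 2| ≤ η * diffNorm g v x ^ 2) (x : M) :
    |energyDensity h v x - energyDensity g v x| ≤ η * energyBound g v x := by
  have ha := gradientCoeff_nonneg hn
  unfold energyDensity energyBound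
  set a := 4 * ((n : ℝ) - 1) / ((n : ℝ) - 2)
  have e : a * diffNorm h v x ^ 2 + scal h x * v x ^ 2
      - (a * diffNorm g v x ^ 2 + scal g x * v x ^ 2)
      = a * (diffNorm h v x ^ 2 - diffNorm g v x ^ 2) + (scal h x - scal g x) * v x ^ 2 := by ring
  rw [e]
  refine (abs_add_le _ _).trans ?_
  rw [abs_mul, abs_mul, abs_of_nonneg ha, abs_of_nonneg (sq_nonneg (v x))]
  have h1 := mul_le_mul_of_nonneg_left (hd v x) ha
  have h2 := mul_le_mul_of_nonneg_right (hs x) (sq_nonneg (v x))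
  have h3 : 0 ≤ η * (|scal g x| * v x ^ 2) := by positivity
  linarith

variable [MeasurableSpace M]

/-- The square of the norm in the denominator of the Yamabe functional. -/
noncomputable def massSq (g : Metr n M) (v : M → ℝ) : ℝ :=
  (eLpNorm v (ENNReal.ofReal (2 * (n : ℝ) / ((n : ℝ) - 2))) (riemMeasure g)).toReal ^ 2

theorem yamabeFunctional_eq (g : Metr n M) (v : M → ℝ) :
    yamabeFunctional g v = (∫ x, energyDensity g v x ∂(riemMeasure g)) / massSq g v := rfl

theorem massSq_nonneg (g : Metr n M) (v : M → ℝ) : 0 ≤ massSq g v := sq_nonneg _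

variable [BorelSpace M]

/-- Off the compact support of v both v and dv vanish, hence so does f. -/
theorem integrable_of_testFunction (g : Metr n M) (hv : v ∈ testFunctions n M) {f : M → ℝ}
    (hf : ChartwiseContinuous n f) (h0 : ∀ x, diffNorm g v x = 0 → v x = 0 → f x = 0) :
    Integrable f (riemMeasure g) :=
  hf.integrable (riemMeasure_chartIndex_eq_lt_top g) hv.2.1 fun x hx =>
    h0 x (diffNorm_eq_zero g hx) (image_eq_zero_of_notMem_tsupport hx)

theorem integrable_energyDensity (g : Metr n M) (hv : v ∈ testFunctions n M) :
    Integrable (energyDensity g v) (riemMeasure g) :=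
  integrable_of_testFunction g hv (chartwiseContinuous_energyDensity g hv) fun x h1 h2 => by
    simp [energyDensity, h1, h2]

theorem integrable_energyBound (g : Metr n M) (hv : v ∈ testFunctions n M) :
    Integrable (energyBound g v) (riemMeasure g) :=
  integrable_of_testFunction g hv (chartwiseContinuous_energyBound g hv) fun x h1 h2 => by
    simp [energyBound, h1, h2]

/-- Stability of the numerator and the denominator of the Yamabe functional. -/
theorem exists_closeMetrics_functional_bounds (hn : 3 ≤ n) {η : ℝ} (hη : 0 < η) (hη1 : η < 1)
    (g : Metr n M) : ∃ ε : ℝ, 0 < ε ∧ ∀ h ∈ uniformBall 2 g ε, ∀ v ∈ testFunctions n M,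
      |∫ x, energyDensity h v x ∂(riemMeasure h) - ∫ x, energyDensity g v x ∂(riemMeasure g)|
        ≤ 3 * η * ∫ x, energyBound g v x ∂(riemMeasure g) ∧
      (1 - η) * massSq g v ≤ massSq h v ∧ massSq h v ≤ (1 + η) * massSq g v := by
  obtain ⟨δ, hδ, H⟩ := exists_closeMetrics_bounds n hη
  refine ⟨δ, hδ, fun h hh v hv => ?_⟩
  obtain ⟨h1, h2, h3, h4⟩ := H (closeMetrics_of_mem_uniformBall hδ.le hh)
  exact ⟨abs_integral_sub_integral_le hη.le hη1.le h1 h2 (integrable_energyDensity g hv)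
    (integrable_energyBound g hv) ((chartwiseContinuous_energyDensity h hv).aestronglyMeasurable _)
    (abs_energyDensity_le hn) (abs_energyDensity_sub_le hn hη.le h3 h4),
    eLpNorm_toReal_sq_bounds hη.le hη1 h1 h2 v (two_le_exponent hn)⟩

/-- A single test function with E_g(v) below the threshold is kept fixed. Its energy bound is a
finite number, so E_h(v) stays below the threshold for h near g. -/
theorem exists_uniformBall_yamabe_lt (hn : 3 ≤ n) (g : Metr n M) {y : EReal} (hy : yamabe g < y) :
    ∃ ε : ℝ, 0 < ε ∧ ∀ h ∈ uniformBall 2 g ε, yamabe h < y := by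
  obtain ⟨z, hz1, hz2⟩ := EReal.lt_iff_exists_real_btwn.1 hy
  have hex : ∃ v ∈ testFunctions n M, ((yamabeFunctional g v : ℝ) : EReal) < z := by
    simpa [yamabe, iInf_lt_iff] using hz1
  obtain ⟨v, hv, hvz⟩ := hex
  have hvz' : yamabeFunctional g v < z := by exact_mod_cast hvz
  suffices hs : ∃ ε : ℝ, 0 < ε ∧ ∀ h ∈ uniformBall 2 g ε, yamabeFunctional h v < z by
    obtain ⟨ε, hε, H⟩ := hs
    refine ⟨ε, hε, fun h hh => lt_of_le_of_lt (iInf₂_le v hv) (lt_trans ?_ hz2)⟩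
    exact_mod_cast H h hh
  rw [yamabeFunctional_eq] at hvz'
  have hm := massSq_nonneg g v
  set Q := ∫ x, energyDensity g v x ∂(riemMeasure g) with hQ
  set I := ∫ x, energyBound g v x ∂(riemMeasure g) with hI
  have hI0 : 0 ≤ I := integral_nonneg fun x => (abs_nonneg _).trans (abs_energyDensity_le hn x)
  set N := massSq g v with hN
  -- If the denominator vanishes for g, it vanishes for h too, and both quotients are 0 by the
  -- convention x / 0 = 0.
  rcases hm.eq_or_lt with hm0 | hm0
  · obtain ⟨ε, hε, H⟩ := exists_closeMetrics_functional_bounds hn (η := 1 / 2) (by norm_num)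
      (by norm_num) g
    refine ⟨ε, hε, fun h hh => ?_⟩
    have h1 := (H h hh v hv).2.2
    rw [← hN, ← hm0, mul_zero] at h1
    rw [yamabeFunctional_eq, le_antisymm h1 (massSq_nonneg h v), div_zero]
    rwa [← hm0, div_zero] at hvz'
  · rw [div_lt_iff₀ hm0] at hvz'
    set d := z * N - Q with hd
    have hd0 : 0 < d := by linarith
    -- Q grows by at most 3ηI and z times the denominator drops by at most |z|ηN, so ηc bounds the
    -- total loss and must stay below the gap d. The summand 1 keeps c positive.
    set c := 3 * I + |z| * N + 1 with hc
    have hc0 : 0 < c := by positivity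
    set η := min (1 / 2) (d / (2 * c)) with hη
    have hη0 : 0 < η := lt_min (by norm_num) (by positivity)
    have hη1 : η < 1 := lt_of_le_of_lt (min_le_left _ _) (by norm_num)
    have hη2 : η * c < d := by
      have : η ≤ d / (2 * c) := min_le_right _ _
      rw [le_div_iff₀ (by positivity)] at this
      linarith
    obtain ⟨ε, hε, H⟩ := exists_closeMetrics_functional_bounds hn hη0 hη1 g
    refine ⟨ε, hε, fun h hh => ?_⟩
    obtain ⟨h1, h2, h3⟩ := H h hh v hv
    have hNh : 0 < massSq h v := lt_of_lt_of_le (mul_pos (by linarith) hm0) h2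
    rw [yamabeFunctional_eq, div_lt_iff₀ hNh]
    have h4 := (abs_le.1 h1).2
    have h5 : |z * (massSq h v - N)| ≤ |z| * (η * N) := by
      rw [abs_mul]
      refine mul_le_mul_of_nonneg_left (abs_le.2 ⟨?_, ?_⟩) (abs_nonneg z) <;> linarith
    have h6 := (abs_le.1 h5).1
    have h7 : η * c = 3 * η * I + |z| * (η * N) + η := by rw [hc]; ring
    linarith

/-- The radius must not depend on the test function. A real gap z < z' between y and the Yamabe
constant is fixed, and the curvature hypotheses bound the perturbation error by the energy and the
squared norm of v alone. -/
theorem exists_uniformBall_lt_yamabe (hn : 3 ≤ n) (g : Metr n M) {ε c : ℝ} (hε : 0 < ε) (hc : 0 < c)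
    (hric : ∀ x : M, ricciNorm g x ≤ c * (1 + |scal g x|))
    (hfin : eLpNorm (fun x : M => -min 0 (scal g x - ε)) (ENNReal.ofReal ((n : ℝ) / 2))
      (riemMeasure g) < ⊤) {y : EReal} (hy : y < yamabe g) :
    ∃ r : ℝ, 0 < r ∧ ∀ h ∈ uniformBall 2 g r, y < yamabe h := by
  obtain ⟨z, hz1, hz2⟩ := EReal.lt_iff_exists_real_btwn.1 hy
  obtain ⟨z', hz3, hz4⟩ := EReal.lt_iff_exists_real_btwn.1 hz2
  have hzz : z < z' := by exact_mod_cast hz3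
  suffices hs : ∃ r : ℝ, 0 < r ∧ ∀ h ∈ uniformBall 2 g r, ∀ v ∈ testFunctions n M,
      z ≤ yamabeFunctional h v by
    obtain ⟨r, hr, H⟩ := hs
    refine ⟨r, hr, fun h hh => lt_of_lt_of_le hz1 (le_iInf₂ fun v hv => ?_)⟩
    exact_mod_cast H h hh v hv
  have hE : ∀ v ∈ testFunctions n M, z' ≤ yamabeFunctional g v := by
    intro v hv
    have : (z' : EReal) ≤ ((yamabeFunctional g v : ℝ) : EReal) := hz4.le.trans (iInf₂_le v hv)
    exact_mod_cast this
  set w : M → ℝ := fun x => -min 0 (scal g x - ε) with hw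
  have hw0 : ∀ x, 0 ≤ w x := fun x => neg_nonneg.2 (min_le_left _ _)
  have hwc : ChartwiseContinuous n w :=
    (chartwiseContinuous_scal g).comp (φ := fun t => -min 0 (t - ε)) (by fun_prop)
  set W := (eLpNorm w (ENNReal.ofReal ((n : ℝ) / 2)) (riemMeasure g)).toReal with hW
  have hW0 : 0 ≤ W := ENNReal.toReal_nonneg
  set C := (1 + c) * (1 + ε⁻¹) with hC
  have hC1 : 1 ≤ C := by
    have : 0 < ε⁻¹ := inv_pos.2 hε
    nlinarith
  have hpt : ∀ x, 1 + ricciNorm g x + |scal g x| ≤ C * (scal g x + 2 * w x) := by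
    intro x
    -- Where scal_g ≥ ε one has w = 0; elsewhere scal_g + 2w = 2ε - scal_g. Both bounds hold in
    -- either case, and the bound by ε absorbs the constant 1 at the price of ε⁻¹.
    have h1 : |scal g x| ≤ scal g x + 2 * w x ∧ ε ≤ scal g x + 2 * w x := by
      simp only [hw]
      rcases le_total 0 (scal g x - ε) with h | h
      · rw [min_eq_left h, abs_of_nonneg (by linarith)]
        constructor <;> linarith
      · rw [min_eq_right h]
        constructor
        · rw [abs_le]
          constructor <;> linarith
        · linarith
    have h2 : 1 ≤ ε⁻¹ * (scal g x + 2 * w x) := by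
      rw [← inv_mul_cancel₀ hε.ne']
      exact mul_le_mul_of_nonneg_left h1.2 (inv_nonneg.2 hε.le)
    have h3 : 1 + |scal g x| ≤ (1 + ε⁻¹) * (scal g x + 2 * w x) := by linarith [h1.1]
    calc _ ≤ (1 + c) * (1 + |scal g x|) := by linarith [hric x]
      _ ≤ (1 + c) * ((1 + ε⁻¹) * (scal g x + 2 * w x)) := by gcongr
      _ = _ := by rw [hC]; ring
  set d := z' - z with hd
  have hd0 : 0 < d := by linarith
  set b := 3 * C * |z'| + 6 * C * W + |z| with hb
  have hb0 : 0 ≤ b := by positivity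
  -- The first entry allows a part of the energy to be absorbed, the second makes the remaining loss
  -- ηb fit into the gap d.
  set η := min (1 / (6 * C)) (d / (b + 1)) with hη
  have hη0 : 0 < η := lt_min (by positivity) (by positivity)
  have hηC : 3 * η * C ≤ 1 / 2 := by
    have : η ≤ 1 / (6 * C) := min_le_left _ _
    rw [le_div_iff₀ (by positivity)] at this
    linarith
  have hη1 : η < 1 := by
    have := mul_le_mul_of_nonneg_left hC1 hη0.le
    linarith
  have hηb : η * b ≤ d := by
    have : η ≤ d / (b + 1) := min_le_right _ _
    rw [le_div_iff₀ (by positivity)] at this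
    linarith
  obtain ⟨r, hr, H⟩ := exists_closeMetrics_functional_bounds hn hη0 hη1 g
  refine ⟨r, hr, fun h hh v hv => ?_⟩
  obtain ⟨h1, h2, h3⟩ := H h hh v hv
  have hEv := hE v hv
  have hm := massSq_nonneg g v
  rw [yamabeFunctional_eq] at hEv ⊢
  rcases hm.eq_or_lt with hm0 | hm0
  · rw [← hm0, mul_zero] at h3
    rw [le_antisymm h3 (massSq_nonneg h v), div_zero]
    rw [← hm0, div_zero] at hEv
    linarith
  have hNh : 0 < massSq h v := lt_of_lt_of_le (mul_pos (by linarith) hm0) h2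
  rw [le_div_iff₀ hm0] at hEv
  rw [le_div_iff₀ hNh]
  have hnR : (3 : ℝ) ≤ n := by exact_mod_cast hn
  have hHolder : ∫ x, w x * v x ^ 2 ∂(riemMeasure g) ≤ W * massSq g v := by
    refine integral_mul_sq_le (by linarith) (by linarith [two_le_exponent hn]) ?_ hw0
      (hwc.aestronglyMeasurable _)
      ((ChartwiseContinuous.of_continuous (n := n) hv.1.continuous).aestronglyMeasurable _)
      hfin.ne ?_
    · have : (n : ℝ) - 2 ≠ 0 := by linarith
      have : (n : ℝ) ≠ 0 := by linarith
      field_simp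
      ring
    -- An infinite norm would have `toReal` equal to 0, against positivity of the mass.
    · intro htop
      rw [massSq, htop] at hm0
      simp at hm0
  have hwi : Integrable (fun x => w x * v x ^ 2) (riemMeasure g) :=
    integrable_of_testFunction g hv (hwc.mul ((ChartwiseContinuous.of_continuous
      hv.1.continuous).comp (φ := fun t => t ^ 2) (by fun_prop))) fun x _ h2 => by simp [h2]
  have hbound : ∫ x, energyBound g v x ∂(riemMeasure g)
      ≤ C * (∫ x, energyDensity g v x ∂(riemMeasure g) + 2 * ∫ x, w x * v x ^ 2 ∂(riemMeasure g)) := by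
    rw [← integral_const_mul, ← integral_add (integrable_energyDensity g hv) (hwi.const_mul 2),
      ← integral_const_mul]
    refine integral_mono (integrable_energyBound g hv)
      (((integrable_energyDensity g hv).add (hwi.const_mul 2)).const_mul C) fun x => ?_
    have e1 := mul_le_mul_of_nonneg_right (hpt x) (sq_nonneg (v x))
    have e2 := mul_nonneg (gradientCoeff_nonneg hn) (sq_nonneg (diffNorm g v x))
    -- `hpt` controls only the zeroth-order terms; the gradient terms compare because C ≥ 1.
    have e3 : 0 ≤ (C - 1) * (4 * ((n : ℝ) - 1) / ((n : ℝ) - 2) * diffNorm g v x ^ 2) :=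
      mul_nonneg (by linarith) e2
    simp only [energyBound, energyDensity]
    linarith
  set Q := ∫ x, energyDensity g v x ∂(riemMeasure g) with hQ
  set I := ∫ x, energyBound g v x ∂(riemMeasure g) with hI
  set N := massSq g v with hN
  exact lower_energy_estimate hη0.le (by linarith) hm0.le hηC rfl hηb hEv
    (hbound.trans (mul_le_mul_of_nonneg_left (by linarith) (by linarith))) h1 h2 h3

end Functional

end YamabeMap

/-! ### Upper semicontinuity and continuity of the Yamabe map. -/

theorem mainTheorem7 (n : ℕ) (hn : 3 ≤ n) (M : Type*) [TopologicalSpace M] [T2Space M]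
    [SecondCountableTopology M] [Nonempty M] [ChartedSpace (EuclideanSpace ℝ (Fin n)) M]
    [IsManifold (𝓡 n) ∞ M] [MeasurableSpace M] [BorelSpace M] :
    (@UpperSemicontinuous (YamabeMap.Metr n M) EReal (YamabeMap.uniformTopology n M 2) _
      (fun g => YamabeMap.yamabe g)) ∧
    ∀ g : YamabeMap.Metr n M,
      (YamabeMap.yamabe g = ⊥ ∨
        ∃ ε c : ℝ, 0 < ε ∧ 0 < c ∧
          (∀ x : M, YamabeMap.ricciNorm g x ≤ c * (1 + |YamabeMap.scal g x|)) ∧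
          eLpNorm (fun x : M => -min 0 (YamabeMap.scal g x - ε))
            (ENNReal.ofReal ((n : ℝ) / 2)) (YamabeMap.riemMeasure g) < ⊤) →
      @ContinuousAt (YamabeMap.Metr n M) EReal (YamabeMap.uniformTopology n M 2) _
        (fun g => YamabeMap.yamabe g) g := by
  let _ := YamabeMap.uniformTopology n M 2
  have husc : UpperSemicontinuous fun g : YamabeMap.Metr n M => YamabeMap.yamabe g := by
    -- A set is open in `uniformTopology` when it contains a ball around each of its points, so a
    -- ball around each metric in the sublevel set is all that is needed.
    rw [upperSemicontinuous_iff_isOpen_preimage]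
    intro y g hg
    exact YamabeMap.exists_uniformBall_yamabe_lt hn g hg
  refine ⟨husc, fun g hg => ?_⟩
  rw [continuousAt_iff_lower_upperSemicontinuousAt]
  refine ⟨fun y hy => ?_, husc g⟩
  rcases hg with hbot | ⟨ε, c, hε, hc, hric, hfin⟩
  · exact absurd hy (by simp [hbot])
  · obtain ⟨r, hr, H⟩ := YamabeMap.exists_uniformBall_lt_yamabe hn g hε hc hric hfin hy
    -- Continuity at a single point, by contrast, needs the ball to be a neighborhood, which rests
    -- on the weak triangle inequality.
    exact Filter.mem_of_superset (YamabeMap.uniformBall_mem_nhds g hr) H
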